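/- Let $0<r_1<\dots<r_K$ and let $\theta\in[0,1]^K$ satisfy $\theta_1\ge\dots\ge\theta_K$ (that is, $\theta\in\mathcal T$). Assume that there is a unique optimal decision $k^\star$, i.e. $r_k\theta_k<r_{k^\star}\theta_{k^\star}$ for all $k\ne k^\star$. When decision $k$ is taken for the $i$-th time, the reward is $r_kX_k(i)$, where for each $k$ the variables $X_k(1),X_k(2),\dots$ are i.i.d. Bernoulli with mean $\theta_k$. (The joint law across different $k$ is arbitrary; in particular the arms may be independent.) For $p,q\in[0,1]$ let $I(p,q)=p\log\frac pq+(1-p)\log\frac{1-p}{1-q}\in[0,\infty]$ be the Bernoulli Kullback--Leibler divergence, with the conventions $0\log\frac 0q=0$ and $p\log\frac p0=\infty$ for $p>0$. Fix a constant $c>0$. The KL-R-UCB algorithm takes decision $n$ in each slot $n=1,\dots,K$, and in each slot $n>K$ it takes a decision maximizing the index $$q_k(n)=\max\Big\{q\in[0,r_k]: t_k(n)\,I\Big(\frac{\hat\mu_k(n)}{r_k},\frac q{r_k}\Big)\le\log n+c\log\log n\Big\},$$ ties being broken arbitrarily, where $t_k(n)$ is the number of times decision $k$ was taken before slot $n$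 and $\hat\mu_k(n)=\frac1{t_k(n)}\sum_{i=1}^{t_k(n)}r_kX_k(i)$. Its regret is $R(T)=r_{k^\star}\theta_{k^\star}T-\sum_k r_k\theta_k\,\mathbb E[N_k(T)]$, where $N_k(T)$ is the number of slots among $1,\dots,T$ in which decision $k$ is taken. Put $k_0=\min\{k\le k^\star: r_{k^\star}\theta_{k^\star}/r_k\le1\}$ and $$c'(\theta)=\sum_{k\ge k_0,\;k\ne k^\star}\frac{r_{k^\star}\theta_{k^\star}-r_k\theta_k}{I\big(\theta_k,\,r_{k^\star}\theta_{k^\star}/r_k\big)},$$ a summand with infinite denominator being $0$. Then for every $\epsilon>0$, as $T\to\infty$, $$R(T)\le(1+\epsilon)\,c'(\theta)\log T+O(\log\log T),$$ where the constant and the threshold implicit in the $O$ depend only on $K$, $(r_k)$, $\theta$, $c$ and $\epsilon$. Consequently $$\limsup_{T\to\infty}\frac{R(T)}{\log T}\le c'(\theta).$$ -/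

import Mathlib

open MeasureTheory ProbabilityTheory Filter Finset

universe u

noncomputable section

/-- One summand `p log (p / q)` of a Kullback-Leibler divergence, for `p, q ∈ [0, 1]`, with the usual
conventions `0 log (0 / q) = 0` and `p log (p / 0) = +∞` when `p > 0`. -/
def klTerm (p q : ℝ) : EReal :=
  if p = 0 then 0 else if q = 0 then ⊤ else ((p * Real.log (p / q) : ℝ) : EReal)

/-- `I(p, q) = p log (p / q) + (1 - p) log ((1 - p) / (1 - q))`, the Kullback-Leibler divergence
between the Bernoulli distributions with parameters `p, q ∈ [0, 1]`; possibly `+∞`. -/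
def bernoulliKL (p q : ℝ) : EReal := klTerm p q + klTerm (1 - p) (1 - q)

/-- The reward model. `X k i ∈ {0, 1}` is the success of the `(i + 1)`-th transmission at rate
`r k`. For each `k` the sequence `X k 0, X k 1, …` is i.i.d. Bernoulli with mean `θ k`. Nothing is
imposed on the joint law across the different `k`. -/
structure IsBernoulliRewards {K : ℕ} {Ω : Type*} [MeasurableSpace Ω] (μ : Measure Ω)
    (θ : Fin K → ℝ) (X : Fin K → ℕ → Ω → ℝ) : Prop where
  measurable : ∀ k i, Measurable (X k i)
  binary : ∀ k i ω, X k i ω = 0 ∨ X k i ω = 1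
  mean : ∀ k i, ∫ ω, X k i ω ∂μ = θ k
  indep : ∀ k, iIndepFun (fun i => X k i) μ

/-- The number of slots `m` with `1 ≤ m < n` in which decision `k` is taken, when `a m` is the
decision taken in slot `m`. -/
def pullsBefore {K : ℕ} {Ω : Type*} (a : ℕ → Ω → Fin K) (k : Fin K) (n : ℕ) (ω : Ω) : ℕ :=
  #{m ∈ Finset.Ico 1 n | a m ω = k}

/-- The empirical average of the rewards `r k * X k i` obtained with decision `k` before slot `n`. -/
def empMean {K : ℕ} {Ω : Type*} (r : Fin K → ℝ) (X : Fin K → ℕ → Ω → ℝ)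
    (a : ℕ → Ω → Fin K) (k : Fin K) (n : ℕ) (ω : Ω) : ℝ :=
  1 / (pullsBefore a k n ω : ℝ) * ∑ i ∈ Finset.range (pullsBefore a k n ω), r k * X k i ω

/-- The index `q_k(n)` of KL-R-UCB with exploration constant `c`. -/
def klIndex {K : ℕ} {Ω : Type*} (r : Fin K → ℝ) (c : ℝ) (X : Fin K → ℕ → Ω → ℝ)
    (a : ℕ → Ω → Fin K) (k : Fin K) (n : ℕ) (ω : Ω) : ℝ :=
  sSup {q : ℝ | q ∈ Set.Icc 0 (r k) ∧
    (pullsBefore a k n ω : EReal) * bernoulliKL (empMean r X a k n ω / r k) (q / r k)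
      ≤ ((Real.log n + c * Real.log (Real.log n) : ℝ) : EReal)}

/-- `a` is a run of KL-R-UCB on the rewards `X`: each of the `K` decisions is taken once, in order,
in slots `1, …, K` (the element `k` of `Fin K` in slot `k + 1`), and afterwards a decision of maximal
index is taken. Ties are broken arbitrarily. -/
structure IsKLRUCB {K : ℕ} {Ω : Type*} [MeasurableSpace Ω] (r : Fin K → ℝ) (c : ℝ)
    (X : Fin K → ℕ → Ω → ℝ) (a : ℕ → Ω → Fin K) : Prop where
  measurable : ∀ n, Measurable (a n)
  init : ∀ (k : Fin K) (ω : Ω), a (k.val + 1) ω = k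
  select : ∀ n, K < n → ∀ (ω : Ω) (j : Fin K),
    klIndex r c X a j n ω ≤ klIndex r c X a (a n ω) n ω

/-- The regret `θ_{k⋆} r_{k⋆} T - ∑_k θ_k r_k E[t_k(T)]`, where `t_k(T)` counts the slots
`1, …, T` in which decision `k` is taken. -/
def regret {K : ℕ} {Ω : Type*} [MeasurableSpace Ω] (μ : Measure Ω) (r θ : Fin K → ℝ)
    (kstar : Fin K) (a : ℕ → Ω → Fin K) (T : ℕ) : ℝ :=
  θ kstar * r kstar * T
    - ∑ k, θ k * r k * ∫ ω, (pullsBefore a k (T + 1) ω : ℝ) ∂μ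

/-- `k₀ = min {k ≤ k⋆ : r_{k⋆} θ_{k⋆} / r_k ≤ 1}`. -/
def kZero {K : ℕ} (r θ : Fin K → ℝ) (kstar : Fin K) : WithTop (Fin K) :=
  Finset.min {k : Fin K | k ≤ kstar ∧ r kstar * θ kstar / r k ≤ 1}

/-- `c'(θ) = ∑_{k ≥ k₀, k ≠ k⋆} (r_{k⋆} θ_{k⋆} - r_k θ_k) / I(θ_k, r_{k⋆} θ_{k⋆} / r_k)`;
a summand with infinite divergence is `0`. -/
def cPrime {K : ℕ} (r θ : Fin K → ℝ) (kstar : Fin K) : ℝ :=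
  ∑ k ∈ Finset.univ.filter (fun k : Fin K => kZero r θ kstar ≤ (k : WithTop (Fin K)) ∧ k ≠ kstar),
    (((r kstar * θ kstar - r k * θ k : ℝ) : EReal)
      / bernoulliKL (θ k) (r kstar * θ kstar / r k)).toReal

end

/-! The pull counts add up to `T`, so the regret is the sum over suboptimal arms of the gap times
the expected number of pulls. Those numbers are bounded on every path by a deterministic term plus a
multiple of `noise`, a count of exceptional events whose expectation is bounded uniformly in `T`.
Each exceptional event concerns the reward sequence of one arm only, so the joint law across arms
plays no role.

Fix `q` slightly below the optimal mean. The index of the optimal arm falls below `r kstar * q` in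
slot `n` with probability of order `n ^ (-(1 + η))`: a Chernoff bound at some `ρ` strictly between
`q` and the mean gains an extra `klReal q ρ` per trial, by the superadditivity `klReal_add_le`.
Hence no refined deviation inequality is needed, and a union bound over the number of trials
suffices (`exists_sum_measure_underestimates_le`).

Outside these events a pulled arm `k` has index at least `r kstar * q`, and three regimes arise. If
`r k < r kstar * θ kstar`, such an index is out of range. If `r k > r kstar * θ kstar`, an arm with
accurate empirical mean is pulled only while its number of trials is at most `exploration / d k`,
where `d k` is within a factor `1 + ε` of the divergence in `cPrime`.

In the boundary case `r k = r kstar * θ kstar` the divergence in `cPrime` is infinite and a bounded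
expected number of pulls is required. After boundedly many accurate trials the index of `k` lies
below `r k` by a relative margin `n ^ (-1/4)`, because the divergence grows logarithmically near the
endpoint `1`. A pull then forces the optimal arm's average below its mean by that margin. This is
rare once that arm has `n / 2` trials, and fewer trials force `noise` to be at least of order `n`
(`lowAverage_of_pull`, `IsTuning.le_noise_of_pullsBefore_lt`). -/

/-! ### Bernoulli divergence: positivity, superadditivity, continuity. -/

/-- The Bernoulli Kullback-Leibler divergence as a real number; it agrees with `bernoulliKL` when
`p ∈ [0, 1]` and `q ∈ (0, 1)`. -/
noncomputable def klReal (p q : ℝ) : ℝ :=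
  p * Real.log (p / q) + (1 - p) * Real.log ((1 - p) / (1 - q))

theorem klTerm_eq_coe {p q : ℝ} (hq : q ≠ 0) :
    klTerm p q = ((p * Real.log (p / q) : ℝ) : EReal) := by
  unfold klTerm
  by_cases hp : p = 0
  · simp [hp]
  · simp [hp, hq]

theorem bernoulliKL_eq_coe {p q : ℝ} (hq0 : 0 < q) (hq1 : q < 1) :
    bernoulliKL p q = (klReal p q : EReal) := by
  unfold bernoulliKL klReal
  rw [klTerm_eq_coe hq0.ne', klTerm_eq_coe (by linarith : (1 - q) ≠ 0), EReal.coe_add]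

theorem bernoulliKL_self (p : ℝ) : bernoulliKL p p = 0 := by
  have h : ∀ x : ℝ, klTerm x x = 0 := by
    intro x
    unfold klTerm
    by_cases hx : x = 0 <;> simp [hx]
  simp [bernoulliKL, h]

theorem bernoulliKL_one_right {p : ℝ} (hp : p < 1) : bernoulliKL p 1 = ⊤ := by
  unfold bernoulliKL
  rw [klTerm_eq_coe one_ne_zero]
  have : klTerm (1 - p) (1 - 1) = ⊤ := by
    unfold klTerm
    rw [if_neg (by linarith), if_pos (by simp)]
  rw [this]
  exact EReal.coe_add_top _

theorem mul_log_div_eq {p q : ℝ} (hq : q ≠ 0) :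
    p * Real.log (p / q) = p * Real.log p - p * Real.log q := by
  by_cases hp : p = 0
  · simp [hp]
  · rw [Real.log_div hp hq]; ring

theorem klReal_eq {p q : ℝ} (hq0 : 0 < q) (hq1 : q < 1) :
    klReal p q = p * Real.log p + (1 - p) * Real.log (1 - p) - p * Real.log q
      - (1 - p) * Real.log (1 - q) := by
  unfold klReal
  rw [mul_log_div_eq hq0.ne', mul_log_div_eq (by linarith : (1 - q) ≠ 0)]
  ring

theorem klReal_eq_klFun {p q : ℝ} (hq0 : 0 < q) (hq1 : q < 1) :
    klReal p q = q * InformationTheory.klFun (p / q)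
      + (1 - q) * InformationTheory.klFun ((1 - p) / (1 - q)) := by
  have h1 : (1 - q) ≠ 0 := by linarith
  unfold klReal InformationTheory.klFun
  field_simp
  ring

theorem klReal_nonneg {p q : ℝ} (hp0 : 0 ≤ p) (hp1 : p ≤ 1) (hq0 : 0 < q) (hq1 : q < 1) :
    0 ≤ klReal p q := by
  rw [klReal_eq_klFun hq0 hq1]
  have h1 := InformationTheory.klFun_nonneg (x := p / q) (by positivity)
  have h2 := InformationTheory.klFun_nonneg (x := (1 - p) / (1 - q))
    (div_nonneg (by linarith) (by linarith))
  have : 0 ≤ 1 - q := by linarith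
  positivity

theorem klReal_pos {p q : ℝ} (hp0 : 0 ≤ p) (hpq : p < q) (hq1 : q < 1) :
    0 < klReal p q := by
  have hq0 : 0 < q := by linarith
  rw [klReal_eq_klFun hq0 hq1]
  have h1 := InformationTheory.klFun_nonneg (x := p / q) (by positivity)
  have h1' : InformationTheory.klFun (p / q) ≠ 0 := by
    rw [Ne, InformationTheory.klFun_eq_zero_iff (by positivity), div_eq_one_iff_eq hq0.ne']
    exact hpq.ne
  have h2 := InformationTheory.klFun_nonneg (x := (1 - p) / (1 - q))
    (div_nonneg (by linarith) (by linarith))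
  have h3 : 0 < q * InformationTheory.klFun (p / q) := mul_pos hq0 (lt_of_le_of_ne h1 h1'.symm)
  have h4 : 0 ≤ (1 - q) * InformationTheory.klFun ((1 - p) / (1 - q)) :=
    mul_nonneg (by linarith) h2
  linarith

/-- The difference of the two sides is `(p - x) * (log (y / p) + log ((1 - p) / (1 - y)))`, a
product of nonnegative factors. Both monotonicity properties of the divergence and the gain in the
Chernoff exponent come from this. -/
theorem klReal_add_le {x p y : ℝ} (hxp : x ≤ p) (hp : 0 < p) (hpy : p ≤ y)
    (hy : y < 1) : klReal x p + klReal p y ≤ klReal x y := by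
  have hy0 : 0 < y := by linarith
  rw [klReal_eq hp (by linarith), klReal_eq hy0 hy, klReal_eq hy0 hy]
  have h1 : Real.log p ≤ Real.log y := Real.log_le_log hp hpy
  have h2 : Real.log (1 - y) ≤ Real.log (1 - p) := Real.log_le_log (by linarith) (by linarith)
  nlinarith [mul_nonneg (sub_nonneg.2 hxp) (sub_nonneg.2 h1),
    mul_nonneg (sub_nonneg.2 hxp) (sub_nonneg.2 h2)]

theorem klReal_anti_left {x p y : ℝ} (hx : 0 ≤ x) (hxp : x ≤ p) (hpy : p ≤ y)
    (hy : y < 1) : klReal p y ≤ klReal x y := by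
  rcases (hx.trans hxp).eq_or_lt with h | h
  · have : x = p := by linarith
    rw [this]
  · have := klReal_add_le hxp h hpy hy
    have := klReal_nonneg hx (by linarith) h (by linarith : p < 1)
    linarith

theorem klReal_mono_right {x p y : ℝ} (hxp : x ≤ p) (hp : 0 < p) (hpy : p ≤ y)
    (hy : y < 1) : klReal x p ≤ klReal x y := by
  have := klReal_add_le hxp hp hpy hy
  have := klReal_nonneg hp.le (by linarith) (by linarith : 0 < y) hy
  linarith

/-- The entropy of `p` is at most `log 2`, and the term with `log q` only helps. This quantifies the
blow-up as `q` tends to `1`, which drives the boundary case. -/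
theorem klReal_ge_log {p q : ℝ} (hp0 : 0 ≤ p) (hq0 : 0 < q) (hq1 : q < 1) :
    -(1 - p) * Real.log (1 - q) - Real.log 2 ≤ klReal p q := by
  rw [klReal_eq hq0 hq1]
  have h := Real.binEntropy_le_log_two (p := p)
  rw [Real.binEntropy_eq_negMulLog_add_negMulLog_one_sub, Real.negMulLog, Real.negMulLog] at h
  have := mul_nonneg hp0 (neg_nonneg.2 (Real.log_nonpos hq0.le hq1.le))
  linarith

theorem continuousAt_klReal {p q : ℝ} (hq0 : 0 < q) (hq1 : q < 1) :
    ContinuousAt (fun z : ℝ × ℝ => klReal z.1 z.2) (p, q) := by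
  have h : (fun z : ℝ × ℝ => klReal z.1 z.2) =ᶠ[nhds (p, q)] fun z =>
      z.1 * Real.log z.1 + (1 - z.1) * Real.log (1 - z.1) - z.1 * Real.log z.2
      - (1 - z.1) * Real.log (1 - z.2) := by
    have h1 : ∀ᶠ z : ℝ × ℝ in nhds (p, q), 0 < z.2 :=
      continuousAt_snd.eventually (lt_mem_nhds hq0)
    have h2 : ∀ᶠ z : ℝ × ℝ in nhds (p, q), z.2 < 1 :=
      continuousAt_snd.eventually (gt_mem_nhds hq1)
    filter_upwards [h1, h2] with z hz0 hz1 using klReal_eq hz0 hz1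
  rw [continuousAt_congr h]
  have c1 : Continuous fun x : ℝ => x * Real.log x := Real.continuous_mul_log
  have c2 : ContinuousAt (fun z : ℝ × ℝ => Real.log z.2) (p, q) :=
    continuousAt_snd.log hq0.ne'
  have c3 : ContinuousAt (fun z : ℝ × ℝ => Real.log (1 - z.2)) (p, q) :=
    (continuousAt_const.sub continuousAt_snd).log (by simp; linarith)
  have c4 : Continuous fun z : ℝ × ℝ => z.1 * Real.log z.1 := c1.comp continuous_fst
  have c5 : Continuous fun z : ℝ × ℝ => (1 - z.1) * Real.log (1 - z.1) :=
    c1.comp (continuous_const.sub continuous_fst)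
  exact (((c4.continuousAt.add c5.continuousAt).sub (continuousAt_fst.mul c2)).sub
    ((continuousAt_const.sub continuousAt_fst).mul c3))

/-! ### Empirical means and the KL index. -/

/-- The mean of the first `m` terms of a sequence of random variables. -/
noncomputable def runningAvg {Ω : Type*} (Y : ℕ → Ω → ℝ) (m : ℕ) (ω : Ω) : ℝ :=
  (∑ i ∈ Finset.range m, Y i ω) / m

/-- The exploration function `log n + c log log n`. -/
noncomputable def exploration (c : ℝ) (n : ℕ) : ℝ := Real.log n + c * Real.log (Real.log n)

theorem runningAvg_mem {Ω : Type*} {Y : ℕ → Ω → ℝ} (hY : ∀ i ω, Y i ω = 0 ∨ Y i ω = 1)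
    (m : ℕ) (ω : Ω) : runningAvg Y m ω ∈ Set.Icc (0 : ℝ) 1 := by
  have h0 : ∀ i, 0 ≤ Y i ω := fun i => by rcases hY i ω with h | h <;> simp [h]
  have h1 : ∀ i, Y i ω ≤ 1 := fun i => by rcases hY i ω with h | h <;> simp [h]
  refine ⟨div_nonneg (Finset.sum_nonneg fun i _ => h0 i) (Nat.cast_nonneg m), ?_⟩
  refine div_le_one_of_le₀ ?_ (Nat.cast_nonneg m)
  calc ∑ i ∈ Finset.range m, Y i ω ≤ ∑ i ∈ Finset.range m, (1 : ℝ) :=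
        Finset.sum_le_sum fun i _ => h1 i
    _ = m := by simp

theorem empMean_div {K : ℕ} {Ω : Type*} {r : Fin K → ℝ} (X : Fin K → ℕ → Ω → ℝ)
    (a : ℕ → Ω → Fin K) {k : Fin K} (hr : 0 < r k) (n : ℕ) (ω : Ω) :
    empMean r X a k n ω / r k = runningAvg (X k) (pullsBefore a k n ω) ω := by
  unfold empMean runningAvg
  rw [← Finset.mul_sum]
  field_simp

section Index

variable {K : ℕ} {Ω : Type*} {r : Fin K → ℝ} {c : ℝ} {X : Fin K → ℕ → Ω → ℝ}
  {a : ℕ → Ω → Fin K} {k : Fin K} {n : ℕ} {ω : Ω}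

theorem le_klIndex {q : ℝ} (hr : 0 < r k) (hq0 : 0 ≤ q) (hq1 : q ≤ 1)
    (h : (pullsBefore a k n ω : EReal)
      * bernoulliKL (runningAvg (X k) (pullsBefore a k n ω) ω) q ≤ (exploration c n : EReal)) :
    r k * q ≤ klIndex r c X a k n ω := by
  unfold klIndex
  refine le_csSup ⟨r k, fun x hx => hx.1.2⟩ ⟨⟨by positivity, by nlinarith⟩, ?_⟩
  rw [empMean_div X a hr, mul_div_cancel_left₀ _ hr.ne']
  exact h

theorem runningAvg_le_klIndex (hX : ∀ i ω, X k i ω = 0 ∨ X k i ω = 1) (hr : 0 < r k)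
    (hf : 0 ≤ exploration c n) :
    r k * runningAvg (X k) (pullsBefore a k n ω) ω ≤ klIndex r c X a k n ω := by
  have h := runningAvg_mem hX (pullsBefore a k n ω) ω
  refine le_klIndex hr h.1 h.2 ?_
  rw [bernoulliKL_self, mul_zero]
  exact_mod_cast hf

theorem of_klIndex_lt (hX : ∀ i ω, X k i ω = 0 ∨ X k i ω = 1) (hr : 0 < r k)
    (hf : 0 ≤ exploration c n) {q : ℝ} (hq0 : 0 < q) (hq1 : q < 1)
    (h : klIndex r c X a k n ω < r k * q) :
    runningAvg (X k) (pullsBefore a k n ω) ω < q ∧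
      exploration c n < pullsBefore a k n ω
        * klReal (runningAvg (X k) (pullsBefore a k n ω) ω) q := by
  constructor
  · have := (runningAvg_le_klIndex (a := a) (ω := ω) hX hr hf).trans_lt h
    exact lt_of_mul_lt_mul_left this hr.le
  · by_contra! hle
    refine absurd (le_klIndex (c := c) (a := a) (n := n) (X := X) (ω := ω) hr hq0.le hq1.le ?_)
      (not_le.2 h)
    rw [bernoulliKL_eq_coe hq0 hq1]
    exact_mod_cast hle

theorem klIndex_le (hX : ∀ i ω, X k i ω = 0 ∨ X k i ω = 1) (hr : 0 < r k)
    (hf : 0 ≤ exploration c n) : klIndex r c X a k n ω ≤ r k := by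
  have h := runningAvg_mem hX (pullsBefore a k n ω) ω
  refine csSup_le ⟨r k * runningAvg (X k) (pullsBefore a k n ω) ω,
    ⟨mul_nonneg hr.le h.1, by nlinarith [h.2]⟩, ?_⟩ fun x hx => hx.1.2
  rw [empMean_div X a hr, mul_div_cancel_left₀ _ hr.ne', bernoulliKL_self, mul_zero]
  exact_mod_cast hf

theorem of_lt_klIndex (hX : ∀ i ω, X k i ω = 0 ∨ X k i ω = 1) (hr : 0 < r k)
    (ht : 0 < pullsBefore a k n ω) {p q : ℝ} (hpq : p ≤ q) (hq0 : 0 < q) (hq1 : q < 1)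
    (hp : runningAvg (X k) (pullsBefore a k n ω) ω ≤ p)
    (h : r k * q < klIndex r c X a k n ω) :
    pullsBefore a k n ω * klReal p q ≤ exploration c n := by
  have hm := runningAvg_mem hX (pullsBefore a k n ω) ω
  set t := pullsBefore a k n ω with htdef
  set x := runningAvg (X k) t ω with hxdef
  have hne : {q : ℝ | q ∈ Set.Icc 0 (r k) ∧ (pullsBefore a k n ω : EReal)
      * bernoulliKL (empMean r X a k n ω / r k) (q / r k)
      ≤ ((Real.log n + c * Real.log (Real.log n) : ℝ) : EReal)}.Nonempty := by
    -- The supremum of the empty set is `0` by convention, which cannot exceed `r k * q`.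
    by_contra hne
    rw [Set.not_nonempty_iff_eq_empty] at hne
    unfold klIndex at h
    rw [hne, Real.sSup_empty] at h
    nlinarith
  obtain ⟨y, ⟨⟨hy0, hy1⟩, hy⟩, hlt⟩ := exists_lt_of_lt_csSup hne h
  rw [empMean_div X a hr, ← htdef, ← hxdef] at hy
  set z := y / r k with hz
  have hqz : q < z := by rw [hz, lt_div_iff₀ hr]; linarith
  have hz1 : z ≤ 1 := by rw [hz, div_le_one hr]; exact hy1
  have ht' : (0 : ℝ) < t := by exact_mod_cast ht
  -- The endpoint `z = 1` is not admissible: the empirical mean is below `1` and there is at least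
  -- one trial, so the constraint would read `⊤ ≤` a real number.
  rcases hz1.eq_or_lt with h1 | h1
  · rw [h1, bernoulliKL_one_right (by linarith : x < 1),
      EReal.mul_top_of_pos (by exact_mod_cast ht)] at hy
    exact absurd hy (not_le.2 (EReal.coe_lt_top _))
  · rw [bernoulliKL_eq_coe (by linarith) h1] at hy
    have hy' : (t : ℝ) * klReal x z ≤ exploration c n := by exact_mod_cast hy
    refine le_trans (mul_le_mul_of_nonneg_left ?_ ht'.le) hy'
    exact (klReal_anti_left hm.1 hp hpq hq1).trans
      (klReal_mono_right (hp.trans hpq) hq0 hqz.le h1)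

end Index

/-! ### Concentration of Bernoulli averages. -/

/-- `Y 0, Y 1, …` are i.i.d. Bernoulli random variables with mean `θ`. -/
structure IsBernoulliSeq {Ω : Type*} [MeasurableSpace Ω] (μ : Measure Ω) (θ : ℝ)
    (Y : ℕ → Ω → ℝ) : Prop where
  measurable : ∀ i, Measurable (Y i)
  binary : ∀ i ω, Y i ω = 0 ∨ Y i ω = 1
  mean : ∀ i, ∫ ω, Y i ω ∂μ = θ
  indep : iIndepFun Y μ

theorem IsBernoulliRewards.isBernoulliSeq {K : ℕ} {Ω : Type*} [MeasurableSpace Ω]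
    {μ : Measure Ω} {θ : Fin K → ℝ} {X : Fin K → ℕ → Ω → ℝ} (h : IsBernoulliRewards μ θ X)
    (k : Fin K) : IsBernoulliSeq μ (θ k) (X k) :=
  ⟨h.measurable k, h.binary k, h.mean k, h.indep k⟩

namespace IsBernoulliSeq

variable {Ω : Type*} [MeasurableSpace Ω] {μ : Measure Ω} {θ : ℝ} {Y : ℕ → Ω → ℝ}

theorem mem_Icc (h : IsBernoulliSeq μ θ Y) (i : ℕ) (ω : Ω) : Y i ω ∈ Set.Icc (0 : ℝ) 1 := by
  rcases h.binary i ω with h | h <;> simp [h]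

theorem measurable_runningAvg (h : IsBernoulliSeq μ θ Y) (m : ℕ) :
    Measurable (runningAvg Y m) :=
  (Finset.measurable_fun_sum _ fun i _ => h.measurable i).div_const _

theorem exists_sum_eq (h : IsBernoulliSeq μ θ Y) (m : ℕ) (z : ℝ) (ω : Ω) :
    ∃ N ≤ m, ∑ i ∈ Finset.range m, Y i ω = N ∧
      ∏ i ∈ Finset.range m, (1 - Y i ω + z * Y i ω) = z ^ N := by
  induction m with
  | zero => exact ⟨0, le_rfl, by simp, by simp⟩
  | succ m ih =>
    obtain ⟨N, hN, hs, hp⟩ := ih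
    rcases h.binary m ω with h0 | h1
    · exact ⟨N, by omega, by rw [Finset.sum_range_succ, hs, h0, add_zero],
        by rw [Finset.prod_range_succ, hp, h0]; simp⟩
    · exact ⟨N + 1, by omega, by rw [Finset.sum_range_succ, hs, h1]; simp,
        by rw [Finset.prod_range_succ, hp, h1, pow_succ]; simp⟩

variable [IsProbabilityMeasure μ]

theorem integrable (h : IsBernoulliSeq μ θ Y) (i : ℕ) : Integrable (Y i) μ :=
  Integrable.of_mem_Icc 0 1 (h.measurable i).aemeasurable (ae_of_all _ (h.mem_Icc i))

theorem hasSubgaussianMGF (h : IsBernoulliSeq μ θ Y) (i : ℕ) :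
    HasSubgaussianMGF (fun ω => Y i ω - θ) (1 / 4) μ := by
  have := hasSubgaussianMGF_of_mem_Icc (μ := μ) (h.measurable i).aemeasurable
    (ae_of_all _ (h.mem_Icc i))
  rw [h.mean i] at this
  convert this using 1
  simp only [sub_zero, nnnorm_one]
  norm_num

theorem hasSubgaussianMGF_neg (h : IsBernoulliSeq μ θ Y) (i : ℕ) :
    HasSubgaussianMGF (fun ω => θ - Y i ω) (1 / 4) μ := by
  have := (h.hasSubgaussianMGF i).neg
  convert this using 1
  ext ω
  simp

theorem measure_runningAvg_ge_le (h : IsBernoulliSeq μ θ Y) {δ : ℝ} (hδ : 0 ≤ δ) (m : ℕ) :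
    μ.real {ω | θ + δ ≤ runningAvg Y m ω} ≤ Real.exp (-(2 * m * δ ^ 2)) := by
  rcases Nat.eq_zero_or_pos m with rfl | hm
  · simp
  have hm' : (0 : ℝ) < m := by exact_mod_cast hm
  have hind : iIndepFun (fun i ω => Y i ω - θ) μ :=
    h.indep.comp (fun _ x => x - θ) fun _ => measurable_id.sub_const θ
  have := HasSubgaussianMGF.measure_sum_range_ge_le_of_iIndepFun hind (n := m)
    (fun i _ => h.hasSubgaussianMGF i) (ε := m * δ) (by positivity)
  refine (measureReal_mono fun ω hω => ?_).trans (this.trans_eq ?_)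
  · simp only [Set.mem_ofPred_eq, runningAvg, le_div_iff₀ hm'] at hω ⊢
    simp only [Finset.sum_sub_distrib, Finset.sum_const, Finset.card_range, nsmul_eq_mul]
    linarith
  · congr 1
    push_cast
    field_simp
    ring

theorem measure_runningAvg_le_le (h : IsBernoulliSeq μ θ Y) {δ : ℝ} (hδ : 0 ≤ δ) (m : ℕ) :
    μ.real {ω | runningAvg Y m ω ≤ θ - δ} ≤ Real.exp (-(2 * m * δ ^ 2)) := by
  rcases Nat.eq_zero_or_pos m with rfl | hm
  · simp
  have hm' : (0 : ℝ) < m := by exact_mod_cast hm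
  have hind : iIndepFun (fun i ω => θ - Y i ω) μ :=
    h.indep.comp (fun _ x => θ - x) fun _ => measurable_id.const_sub θ
  have := HasSubgaussianMGF.measure_sum_range_ge_le_of_iIndepFun hind (n := m)
    (fun i _ => h.hasSubgaussianMGF_neg i) (ε := m * δ) (by positivity)
  refine (measureReal_mono fun ω hω => ?_).trans (this.trans_eq ?_)
  · simp only [Set.mem_ofPred_eq, runningAvg, div_le_iff₀ hm'] at hω ⊢
    simp only [Finset.sum_sub_distrib, Finset.sum_const, Finset.card_range, nsmul_eq_mul]
    linarith
  · congr 1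
    push_cast
    field_simp
    ring

theorem integral_prod (h : IsBernoulliSeq μ θ Y) (m : ℕ) (z : ℝ) :
    ∫ ω, ∏ i ∈ Finset.range m, (1 - Y i ω + z * Y i ω) ∂μ = (1 - θ + z * θ) ^ m := by
  have hg : Measurable fun x : ℝ => 1 - x + z * x := by fun_prop
  have hind : iIndepFun (fun (i : Fin m) ω => 1 - Y i ω + z * Y i ω) μ :=
    (h.indep.comp (fun _ x => 1 - x + z * x) fun _ => hg).precomp Fin.val_injective
  have := hind.integral_fun_prod_eq_prod_integral
    fun i => (hg.comp (h.measurable i)).aestronglyMeasurable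
  have h2 : ∀ i : ℕ, ∫ ω, (1 - Y i ω + z * Y i ω) ∂μ = 1 - θ + z * θ := by
    intro i
    have h1 : Integrable (fun ω => 1 - Y i ω) μ := (integrable_const 1).sub (h.integrable i)
    rw [integral_add h1 ((h.integrable i).const_mul z),
      integral_sub (integrable_const _) (h.integrable i), integral_const_mul, h.mean i]
    simp
  simp only [h2, Finset.prod_const, Finset.card_univ, Fintype.card_fin] at this
  rw [← this]
  congr 1
  ext ω
  exact Finset.prod_range fun i => (1 - Y i ω + z * Y i ω)

/-- Markov's inequality for `z ^ S`, where `S` is the number of successes; `1 - Y + z * Y` equals `z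
^ Y` for binary `Y`. Using `z` rather than an exponential keeps `z = 0` available, which is needed
for `j = 0`. -/
theorem measure_sum_le_mul_le (h : IsBernoulliSeq μ θ Y) (m j : ℕ) {z : ℝ} (hz0 : 0 ≤ z)
    (hz1 : z ≤ 1) :
    z ^ j * μ.real {ω | ∑ i ∈ Finset.range m, Y i ω ≤ j} ≤ (1 - θ + z * θ) ^ m := by
  rw [← h.integral_prod m z]
  set g : Ω → ℝ := fun ω => ∏ i ∈ Finset.range m, (1 - Y i ω + z * Y i ω) with hg
  have hg01 : ∀ ω, g ω ∈ Set.Icc (0 : ℝ) 1 := by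
    intro ω
    obtain ⟨N, -, -, hp⟩ := h.exists_sum_eq m z ω
    rw [hg]
    simp only [hp]
    exact ⟨pow_nonneg hz0 N, pow_le_one₀ hz0 hz1⟩
  have hgm : Measurable g := Finset.measurable_fun_prod _ fun i _ =>
    ((h.measurable i).const_sub 1).add ((h.measurable i).const_mul z)
  have hint : Integrable g μ := Integrable.of_mem_Icc 0 1 hgm.aemeasurable (ae_of_all _ hg01)
  refine le_trans ?_ (mul_meas_ge_le_integral_of_nonneg (ae_of_all _ fun ω => (hg01 ω).1) hint
    (z ^ j))
  refine mul_le_mul_of_nonneg_left (measureReal_mono fun ω hω => ?_) (by positivity)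
  obtain ⟨N, -, hs, hp⟩ := h.exists_sum_eq m z ω
  simp only [Set.mem_ofPred_eq, hs] at hω
  simp only [Set.mem_ofPred_eq, hg, hp]
  exact pow_le_pow_of_le_one hz0 hz1 (by exact_mod_cast hω)

/-- Chernoff bound for the lower tail of a binomial random variable. -/
theorem measure_sum_le_le (h : IsBernoulliSeq μ θ Y) {m j : ℕ} (hm : 0 < m) {ρ : ℝ}
    (hρ0 : 0 < ρ) (hρ1 : ρ < 1) (hρθ : ρ ≤ θ) (hj : (j : ℝ) / m ≤ ρ) :
    μ.real {ω | ∑ i ∈ Finset.range m, Y i ω ≤ j} ≤ Real.exp (-(m * klReal ((j : ℝ) / m) ρ)) := by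
  have hm' : (0 : ℝ) < m := by exact_mod_cast hm
  set x : ℝ := (j : ℝ) / m with hx
  have hx0 : 0 ≤ x := by positivity
  have hjx : (j : ℝ) = m * x := by rw [hx]; field_simp
  have h1x : 0 < 1 - x := by linarith
  have h1ρ : 0 < 1 - ρ := by linarith
  -- The optimal tilt for a Bernoulli variable of mean `ρ`. Since `z ≤ 1`, the generating function
  -- decreases in the mean, so the bound for `ρ` also covers `θ ≥ ρ`.
  set z : ℝ := x * (1 - ρ) / (ρ * (1 - x)) with hz
  have hz0 : 0 ≤ z := by positivity
  have hz1 : z ≤ 1 := by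
    rw [hz, div_le_one (by positivity)]
    nlinarith
  have hθ1 : θ ≤ 1 := by
    rw [← h.mean 0]
    have := integral_mono (h.integrable 0) (integrable_const (1 : ℝ)) fun ω => (h.mem_Icc 0 ω).2
    simpa using this
  have hb : (1 - θ + z * θ) ^ m ≤ ((1 - ρ) / (1 - x)) ^ m := by
    have : (1 - ρ) / (1 - x) = 1 - ρ + z * ρ := by
      rw [hz]; field_simp; ring
    rw [this]
    refine pow_le_pow_left₀ (add_nonneg (by linarith) (mul_nonneg hz0 (by linarith))) ?_ m
    nlinarith
  have key := (h.measure_sum_le_mul_le m j hz0 hz1).trans hb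
  have hzj : 0 < z ^ j := by
    rcases Nat.eq_zero_or_pos j with h0 | h0
    · rw [h0, pow_zero]; exact one_pos
    · have : 0 < x := by rw [hx]; positivity
      positivity
  rw [← le_div_iff₀' hzj] at key
  refine key.trans_eq ?_
  rw [← Real.exp_log (show 0 < ((1 - ρ) / (1 - x)) ^ m / z ^ j by positivity)]
  congr 1
  rw [Real.log_div (by positivity) hzj.ne', Real.log_pow, Real.log_pow, hjx, klReal]
  rw [Real.log_div h1ρ.ne' h1x.ne', Real.log_div h1x.ne' h1ρ.ne', mul_log_div_eq hρ0.ne']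
  rcases hx0.eq_or_lt with h0 | h0
  · rw [← h0]; simp
  · rw [hz, Real.log_div (by positivity) (by positivity), Real.log_mul h0.ne' h1ρ.ne',
      Real.log_mul hρ0.ne' h1x.ne']
    ring

/-- The second factor makes the bound summable over `m`, and the surplus over `1` in the coefficient
of `f` makes it summable over slots once `f` is at least `log n`. -/
theorem measure_runningAvg_lt_klReal_le (h : IsBernoulliSeq μ θ Y) {m : ℕ} (hm : 0 < m)
    {q ρ f : ℝ} (hq0 : 0 < q) (hqρ : q ≤ ρ) (hρ1 : ρ < 1) (hρθ : ρ ≤ θ) :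
    μ.real {ω | runningAvg Y m ω < q ∧ f < m * klReal (runningAvg Y m ω) q} ≤
      Real.exp (-((1 + klReal q ρ / (2 * klReal 0 q)) * f)) * Real.exp (-(klReal q ρ / 2 * m)) := by
  classical
  have hm' : (0 : ℝ) < m := by exact_mod_cast hm
  have hM : 0 < klReal 0 q := klReal_pos le_rfl hq0 (by linarith)
  have hκ : 0 ≤ klReal q ρ := klReal_nonneg hq0.le (by linarith) (by linarith) hρ1
  -- The success counts compatible with the event. The event lies in the lower tail cut at the
  -- largest of them, so a single Chernoff bound suffices.
  set J := (Finset.range (m + 1)).filter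
    fun j : ℕ => (j : ℝ) / m < q ∧ f < m * klReal ((j : ℝ) / m) q with hJ
  have hsub : ∀ ω, runningAvg Y m ω < q ∧ f < m * klReal (runningAvg Y m ω) q →
      ∃ j ∈ J, ∑ i ∈ Finset.range m, Y i ω = (j : ℝ) := by
    intro ω hω
    obtain ⟨N, hN, hs, -⟩ := h.exists_sum_eq m 0 ω
    refine ⟨N, ?_, hs⟩
    rw [hJ, Finset.mem_filter, Finset.mem_range]
    refine ⟨by omega, ?_⟩
    simpa only [runningAvg, hs] using hω
  rcases J.eq_empty_or_nonempty with he | hne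
  · have : {ω | runningAvg Y m ω < q ∧ f < m * klReal (runningAvg Y m ω) q} = ∅ := by
      ext ω
      simp only [Set.mem_ofPred_eq, Set.mem_empty_iff_false, iff_false]
      intro hω
      obtain ⟨j, hj, -⟩ := hsub ω hω
      simp [he] at hj
    rw [this, measureReal_empty]
    positivity
  · obtain ⟨-, hlt, hfl⟩ := by simpa only [hJ, Finset.mem_filter] using J.max'_mem hne
    set j := J.max' hne with hj
    have hx0 : (0 : ℝ) ≤ (j : ℝ) / m := by positivity
    refine (measureReal_mono (s₂ := {ω | ∑ i ∈ Finset.range m, Y i ω ≤ (j : ℝ)})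
      fun ω hω => ?_).trans ((h.measure_sum_le_le hm (by linarith) hρ1 hρθ
        (by linarith)).trans ?_)
    · obtain ⟨i, hi, hs⟩ := hsub ω hω
      rw [Set.mem_ofPred_eq, hs]
      exact_mod_cast J.le_max' i hi
    · rw [← Real.exp_add]
      refine Real.exp_le_exp.2 ?_
      have h1 := klReal_add_le hlt.le hq0 hqρ hρ1
      have h2 := klReal_anti_left le_rfl hx0 hlt.le (by linarith)
      have h3 : f ≤ m * klReal 0 q := hfl.le.trans (mul_le_mul_of_nonneg_left h2 hm'.le)
      -- Half of the gain `m * klReal q ρ` is traded for a multiple of `f`, using `f ≤ m * klReal 0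
      -- q`; the other half is kept for summing over `m`.
      have h4 : klReal q ρ / (2 * klReal 0 q) * f ≤ klReal q ρ / 2 * m := by
        rw [div_mul_eq_mul_div, div_le_iff₀ (by positivity)]
        nlinarith
      nlinarith

end IsBernoulliSeq

/-! ### Summability of the exceptional events. -/

theorem log_le_exploration {c : ℝ} (hc : 0 ≤ c) {n : ℕ} (hn : 3 ≤ n) :
    Real.log n ≤ exploration c n := by
  have h3 : (3 : ℝ) ≤ n := by exact_mod_cast hn
  have : 1 ≤ Real.log n := by
    rw [Real.le_log_iff_exp_le (by linarith)]
    linarith [Real.exp_one_lt_d9]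
  unfold exploration
  nlinarith [mul_nonneg hc (Real.log_nonneg this)]

/-- The event that after some number `s ≤ n` of trials the empirical mean is so far below `q`
that `q` lies above the exploration threshold of slot `n`. -/
def underestimates {Ω : Type*} (c q : ℝ) (Y : ℕ → Ω → ℝ) (n : ℕ) : Set Ω :=
  {ω | ∃ s ∈ Finset.Icc 1 n, runningAvg Y s ω < q ∧
    exploration c n < s * klReal (runningAvg Y s ω) q}

/-- The event that some empirical mean over at least `n / 2` and at most `n` trials is below
`(1 - n ^ (-1 / 4))` times its expectation. -/
def lowAverage {Ω : Type*} (θ : ℝ) (Y : ℕ → Ω → ℝ) (n : ℕ) : Set Ω :=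
  {ω | ∃ s ∈ Finset.Icc 1 n, (n : ℝ) / 2 ≤ s ∧
    runningAvg Y s ω ≤ θ - θ * (n : ℝ) ^ (-(1 / 4) : ℝ)}

section Summation

variable {θ : ℝ}

theorem exists_setOf_eq_biUnion {Ω : Type*} (s : Finset ℕ) (p : ℕ → Ω → Prop) :
    {ω | ∃ i ∈ s, p i ω} = ⋃ i ∈ s, {ω | p i ω} := by
  ext ω
  simp

theorem exists_sum_measure_underestimates_le {c q : ℝ} (hc : 0 ≤ c) (hq0 : 0 < q) (hqθ : q < θ)
    (hθ : θ ≤ 1) :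
    ∃ C : ℝ, ∀ (Ω : Type u) [MeasurableSpace Ω] (μ : Measure Ω) [IsProbabilityMeasure μ]
      (Y : ℕ → Ω → ℝ), IsBernoulliSeq μ θ Y → ∀ T : ℕ,
        ∑ n ∈ Finset.Icc 3 T, μ.real (underestimates c q Y n) ≤ C := by
  obtain ⟨ρ, hqρ, hρθ⟩ := exists_between hqθ
  have hρ1 : ρ < 1 := by linarith
  have hM : 0 < klReal 0 q := klReal_pos le_rfl hq0 (by linarith)
  have hκ : 0 < klReal q ρ := klReal_pos hq0.le hqρ hρ1
  set κ := klReal q ρ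
  set η := κ / (2 * klReal 0 q)
  have hη : 0 < η := by positivity
  have hs1 : Summable fun s : ℕ => Real.exp (-(κ / 2 * s)) := by
    have := Real.summable_exp_nat_mul_iff (a := -(κ / 2)) |>.2 (by linarith)
    refine this.congr fun s => ?_
    congr 1
    ring
  have hs2 : Summable fun n : ℕ => (n : ℝ) ^ (-(1 + η)) :=
    Real.summable_nat_rpow.2 (by linarith)
  refine ⟨(∑' n : ℕ, (n : ℝ) ^ (-(1 + η))) * ∑' s : ℕ, Real.exp (-(κ / 2 * s)), ?_⟩
  intro Ω _ μ _ Y hY T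
  have hn : ∀ n ∈ Finset.Icc 3 T, μ.real (underestimates c q Y n) ≤
      (n : ℝ) ^ (-(1 + η)) * ∑' s : ℕ, Real.exp (-(κ / 2 * s)) := by
    intro n hn
    have hn3 : 3 ≤ n := (Finset.mem_Icc.1 hn).1
    have hf := log_le_exploration hc hn3
    have hn0 : (0 : ℝ) < n := by positivity
    have hl0 : 0 ≤ Real.log n := Real.log_natCast_nonneg n
    unfold underestimates
    rw [exists_setOf_eq_biUnion]
    refine (measureReal_biUnion_finset_le _ _).trans ?_
    have : ∀ s ∈ Finset.Icc 1 n, μ.real {ω | runningAvg Y s ω < q ∧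
        exploration c n < s * klReal (runningAvg Y s ω) q} ≤
        (n : ℝ) ^ (-(1 + η)) * Real.exp (-(κ / 2 * s)) := by
      intro s hs
      refine (hY.measure_runningAvg_lt_klReal_le (Finset.mem_Icc.1 hs).1 hq0 hqρ.le hρ1
        hρθ.le).trans ?_
      refine mul_le_mul_of_nonneg_right ?_ (Real.exp_pos _).le
      rw [Real.rpow_def_of_pos hn0]
      refine Real.exp_le_exp.2 ?_
      nlinarith
    refine (Finset.sum_le_sum this).trans ?_
    rw [← Finset.mul_sum]
    exact mul_le_mul_of_nonneg_left (hs1.sum_le_tsum _ fun _ _ => (Real.exp_pos _).le)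
      (by positivity)
  refine (Finset.sum_le_sum hn).trans ?_
  rw [← Finset.sum_mul]
  exact mul_le_mul_of_nonneg_right (hs2.sum_le_tsum _ fun _ _ => by positivity)
    (tsum_nonneg fun _ => (Real.exp_pos _).le)

theorem exists_sum_measure_lowAverage_le (hθ : 0 < θ) :
    ∃ C : ℝ, ∀ (Ω : Type u) [MeasurableSpace Ω] (μ : Measure Ω) [IsProbabilityMeasure μ]
      (Y : ℕ → Ω → ℝ), IsBernoulliSeq μ θ Y → ∀ T : ℕ,
        ∑ n ∈ Finset.Icc 3 T, μ.real (lowAverage θ Y n) ≤ C := by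
  have hs : Summable fun n : ℕ => 720 / θ ^ 12 * (1 / (n : ℝ) ^ 2) :=
    (Real.summable_one_div_nat_pow.2 one_lt_two).mul_left _
  refine ⟨∑' n : ℕ, 720 / θ ^ 12 * (1 / (n : ℝ) ^ 2), ?_⟩
  intro Ω _ μ _ Y hY T
  refine le_trans (Finset.sum_le_sum fun n hn => ?_)
    (hs.sum_le_tsum (Finset.Icc 3 T) fun _ _ => by positivity)
  have hn3 : 3 ≤ n := (Finset.mem_Icc.1 hn).1
  have hn0 : (0 : ℝ) < n := by positivity
  -- Hoeffding's exponent `2 * s * (θ * n ^ (-1/4)) ^ 2` is at least `y` when `s ≥ n / 2`.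
  set y := θ ^ 2 * Real.sqrt n with hy
  have hy0 : 0 < y := by positivity
  have hsub : lowAverage θ Y n ⊆ ⋃ s ∈ (Finset.Icc 1 n).filter (fun s : ℕ => (n : ℝ) / 2 ≤ s),
      {ω | runningAvg Y s ω ≤ θ - θ * (n : ℝ) ^ (-(1 / 4) : ℝ)} := by
    rintro ω ⟨s, hs, hs2, h⟩
    simp only [Set.mem_iUnion]
    exact ⟨s, Finset.mem_filter.2 ⟨hs, hs2⟩, h⟩
  refine (measureReal_mono hsub (measure_ne_top _ _)).trans ((measureReal_biUnion_finset_le _ _).trans ?_)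
  have hterm : ∀ s ∈ (Finset.Icc 1 n).filter (fun s : ℕ => (n : ℝ) / 2 ≤ s),
      μ.real {ω | runningAvg Y s ω ≤ θ - θ * (n : ℝ) ^ (-(1 / 4) : ℝ)} ≤ Real.exp (-y) := by
    intro s hs
    have hs2 := (Finset.mem_filter.1 hs).2
    refine (hY.measure_runningAvg_le_le (by positivity) s).trans (Real.exp_le_exp.2 ?_)
    have h1 : ((n : ℝ) ^ (-(1 / 4) : ℝ)) ^ 2 * n = Real.sqrt n := by
      rw [Real.sqrt_eq_rpow, ← Real.rpow_natCast, ← Real.rpow_mul hn0.le]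
      nth_rewrite 2 [← Real.rpow_one (n : ℝ)]
      rw [← Real.rpow_add hn0]
      norm_num
    rw [hy, ← h1, mul_pow]
    have : 0 ≤ θ ^ 2 * ((n : ℝ) ^ (-(1 / 4) : ℝ)) ^ 2 := by positivity
    nlinarith
  refine (Finset.sum_le_sum hterm).trans ?_
  rw [Finset.sum_const, nsmul_eq_mul]
  have hcard : (((Finset.Icc 1 n).filter (fun s : ℕ => (n : ℝ) / 2 ≤ s)).card : ℝ) ≤ n := by
    have := Finset.card_filter_le (Finset.Icc 1 n) (fun s : ℕ => (n : ℝ) / 2 ≤ s)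
    rw [Nat.card_Icc] at this
    exact_mod_cast this
  refine (mul_le_mul_of_nonneg_right hcard (Real.exp_pos _).le).trans ?_
  -- The sixth power of `y` is of order `n ^ 3`, which absorbs the factor `n` of the union bound and
  -- leaves `1 / n ^ 2`.
  have hexp := Real.pow_div_factorial_le_exp y hy0.le 6
  have h6 : y ^ 6 = θ ^ 12 * (n : ℝ) ^ 3 := by
    have : Real.sqrt n ^ 6 = (n : ℝ) ^ 3 := by
      rw [show (6 : ℕ) = 2 * 3 from rfl, pow_mul, Real.sq_sqrt hn0.le]
    rw [hy, mul_pow, this]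
    ring
  rw [h6] at hexp
  have hfac : ((Nat.factorial 6 : ℕ) : ℝ) = 720 := by norm_num [Nat.factorial]
  rw [hfac, div_le_iff₀ (by norm_num)] at hexp
  rw [Real.exp_neg, ← div_eq_mul_inv, div_le_iff₀ (Real.exp_pos _), div_mul_div_comm,
    div_mul_eq_mul_div, le_div_iff₀ (by positivity)]
  nlinarith

theorem exists_sum_measure_runningAvg_gt_le {p : ℝ} (hp : θ < p) :
    ∃ C : ℝ, ∀ (Ω : Type u) [MeasurableSpace Ω] (μ : Measure Ω) [IsProbabilityMeasure μ]
      (Y : ℕ → Ω → ℝ), IsBernoulliSeq μ θ Y → ∀ T : ℕ,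
        ∑ m ∈ Finset.range T, μ.real {ω | p < runningAvg Y m ω} ≤ C := by
  have hs : Summable fun m : ℕ => Real.exp (-(2 * m * (p - θ) ^ 2)) := by
    have := Real.summable_exp_nat_mul_iff (a := -(2 * (p - θ) ^ 2)) |>.2
      (by nlinarith [sub_pos.2 hp])
    refine this.congr fun s => ?_
    congr 1
    ring
  refine ⟨∑' m : ℕ, Real.exp (-(2 * m * (p - θ) ^ 2)), ?_⟩
  intro Ω _ μ _ Y hY T
  refine le_trans (Finset.sum_le_sum fun m _ => ?_)
    (hs.sum_le_tsum (Finset.range T) fun _ _ => (Real.exp_pos _).le)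
  refine (measureReal_mono fun ω hω => ?_).trans (hY.measure_runningAvg_ge_le (sub_pos.2 hp).le m)
  simp only [Set.mem_ofPred_eq] at hω ⊢
  linarith

end Summation

/-! ### Measurability of the exceptional events. -/

section Measurability

variable {Ω : Type*} [MeasurableSpace Ω] {μ : Measure Ω} {θ : ℝ} {Y : ℕ → Ω → ℝ}

theorem IsBernoulliSeq.measurableSet_underestimates (h : IsBernoulliSeq μ θ Y) (c q : ℝ) (n : ℕ) :
    MeasurableSet (underestimates c q Y n) := by
  unfold underestimates
  rw [exists_setOf_eq_biUnion]
  refine Finset.measurableSet_biUnion _ fun s _ => ?_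
  have hm := h.measurable_runningAvg s
  have hk : Measurable fun ω => (s : ℝ) * klReal (runningAvg Y s ω) q := by
    unfold klReal
    fun_prop
  exact (measurableSet_lt hm measurable_const).inter (measurableSet_lt measurable_const hk)

theorem IsBernoulliSeq.measurableSet_lowAverage (h : IsBernoulliSeq μ θ Y) (n : ℕ) :
    MeasurableSet (lowAverage θ Y n) := by
  unfold lowAverage
  rw [exists_setOf_eq_biUnion]
  refine Finset.measurableSet_biUnion _ fun s _ => ?_
  exact (MeasurableSet.const _).inter
    (measurableSet_le (h.measurable_runningAvg s) measurable_const)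

end Measurability

/-! ### Counting pulls along a path. -/

section Counting

variable {K : ℕ} {Ω : Type*} {a : ℕ → Ω → Fin K} {k : Fin K}

theorem pullsBefore_le (n : ℕ) (ω : Ω) : pullsBefore a k n ω ≤ n := by
  unfold pullsBefore
  refine (Finset.card_filter_le _ _).trans ?_
  rw [Nat.card_Ico]
  omega

theorem pullsBefore_lt {m n : ℕ} (ω : Ω) (hm : 1 ≤ m) (hmn : m < n) (hk : a m ω = k) :
    pullsBefore a k m ω < pullsBefore a k n ω := by
  unfold pullsBefore
  refine Finset.card_lt_card ⟨fun i hi => ?_, fun hss => ?_⟩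
  · rw [Finset.mem_filter, Finset.mem_Ico] at hi ⊢
    exact ⟨⟨hi.1.1, hi.1.2.trans hmn⟩, hi.2⟩
  · have := hss (Finset.mem_filter.2 ⟨Finset.mem_Ico.2 ⟨hm, hmn⟩, hk⟩)
    rw [Finset.mem_filter, Finset.mem_Ico] at this
    omega

theorem sum_pullsBefore (a : ℕ → Ω → Fin K) (n : ℕ) (ω : Ω) :
    ∑ k, pullsBefore a k n ω = n - 1 := by
  unfold pullsBefore
  rw [← Finset.card_eq_sum_card_fiberwise fun _ _ => Finset.mem_coe.2 (Finset.mem_univ _),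
    Nat.card_Ico]

/-- Over the slots in which `k` is taken, the trial number is strictly increasing. A condition on
the trial number is therefore charged once per trial, while `Q` is charged once per slot. -/
theorem pullsBefore_succ_le {n₀ T : ℕ} (hn₀ : 1 ≤ n₀) (ω : Ω) (P Q : ℕ → Prop)
    [DecidablePred P] [DecidablePred Q]
    (h : ∀ n, n₀ ≤ n → n ≤ T → a n ω = k → P (pullsBefore a k n ω) ∨ Q n) :
    pullsBefore a k (T + 1) ω ≤
      n₀ + #{m ∈ Finset.range (T + 1) | P m} + #{n ∈ Finset.Icc n₀ T | Q n} := by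
  have hsub : {m ∈ Finset.Ico 1 (T + 1) | a m ω = k} ⊆
      (Finset.range n₀ ∪ {n ∈ Finset.Icc n₀ T | a n ω = k ∧ P (pullsBefore a k n ω)}) ∪
        {n ∈ Finset.Icc n₀ T | Q n} := by
    intro n hn
    simp only [Finset.mem_filter, Finset.mem_Ico, Finset.mem_union, Finset.mem_range,
      Finset.mem_Icc] at hn ⊢
    by_cases hlt : n < n₀
    · exact Or.inl (Or.inl hlt)
    · rcases h n (by omega) (by omega) hn.2 with h | h
      · exact Or.inl (Or.inr ⟨⟨by omega, by omega⟩, hn.2, h⟩)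
      · exact Or.inr ⟨⟨by omega, by omega⟩, h⟩
  have hinj : #{n ∈ Finset.Icc n₀ T | a n ω = k ∧ P (pullsBefore a k n ω)} ≤
      #{m ∈ Finset.range (T + 1) | P m} := by
    refine Finset.card_le_card_of_injOn (fun n => pullsBefore a k n ω) ?_ ?_
    · intro n hn
      simp only [Finset.coe_filter, Finset.mem_Icc, Set.mem_ofPred_eq, Finset.mem_range] at hn ⊢
      exact ⟨by have := pullsBefore_le (a := a) (k := k) n ω; omega, hn.2.2⟩
    · intro m hm n hn hmn
      simp only [Finset.coe_filter, Finset.mem_Icc, Set.mem_ofPred_eq] at hm hn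
      rcases lt_trichotomy m n with hlt | heq | hlt
      · exact absurd hmn (pullsBefore_lt ω (by omega) hlt hm.2.1).ne
      · exact heq
      · exact absurd hmn (pullsBefore_lt ω (by omega) hlt hn.2.1).ne'
  calc pullsBefore a k (T + 1) ω ≤ _ := Finset.card_le_card hsub
    _ ≤ _ := Finset.card_union_le _ _
    _ ≤ _ := by
      gcongr
      refine (Finset.card_union_le _ _).trans ?_
      rw [Finset.card_range]
      gcongr

open Classical in
theorem card_filter_natCast_le (T : ℕ) {L : ℝ} (hL : 0 ≤ L) :
    ((#{m ∈ Finset.range T | ((m : ℕ) : ℝ) ≤ L} : ℕ) : ℝ) ≤ L + 1 := by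
  have hsub : {m ∈ Finset.range T | ((m : ℕ) : ℝ) ≤ L} ⊆ Finset.range (⌊L⌋₊ + 1) := by
    intro m hm
    rw [Finset.mem_filter] at hm
    rw [Finset.mem_range, Nat.lt_succ_iff]
    exact Nat.le_floor hm.2
  have := Finset.card_le_card hsub
  rw [Finset.card_range] at this
  calc ((#{m ∈ Finset.range T | ((m : ℕ) : ℝ) ≤ L} : ℕ) : ℝ) ≤ ((⌊L⌋₊ + 1 : ℕ) : ℝ) := by
        exact_mod_cast this
    _ ≤ L + 1 := by push_cast; linarith [Nat.floor_le hL]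

theorem IsKLRUCB.pullsBefore_pos [MeasurableSpace Ω] {r : Fin K → ℝ} {c : ℝ}
    {X : Fin K → ℕ → Ω → ℝ} (h : IsKLRUCB r c X a) (k : Fin K) {n : ℕ} (hn : K < n) (ω : Ω) :
    0 < pullsBefore a k n ω := by
  refine Finset.card_pos.2 ⟨k.val + 1, Finset.mem_filter.2 ⟨Finset.mem_Ico.2 ?_, h.init k ω⟩⟩
  have := k.isLt
  omega

end Counting

/-! ### Growth of the exploration function. -/

theorem exploration_mono {c : ℝ} (hc : 0 ≤ c) {m n : ℕ} (hm : 3 ≤ m) (hmn : m ≤ n) :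
    exploration c m ≤ exploration c n := by
  have h3 : (3 : ℝ) ≤ m := by exact_mod_cast hm
  have hmn' : (m : ℝ) ≤ n := by exact_mod_cast hmn
  have h1 : Real.log m ≤ Real.log n := Real.log_le_log (by linarith) hmn'
  have h0 : 0 < Real.log m := Real.log_pos (by linarith)
  unfold exploration
  nlinarith [mul_le_mul_of_nonneg_left (Real.log_le_log h0 h1) hc]

theorem exploration_nonneg {c : ℝ} (hc : 0 ≤ c) {n : ℕ} (hn : 3 ≤ n) : 0 ≤ exploration c n :=
  (Real.log_natCast_nonneg n).trans (log_le_exploration hc hn)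

theorem tendsto_log_natCast : Tendsto (fun n : ℕ => Real.log n) atTop atTop :=
  Real.tendsto_log_atTop.comp tendsto_natCast_atTop_atTop

theorem eventually_exploration_le (c : ℝ) :
    ∀ᶠ n : ℕ in atTop, exploration c n ≤ 2 * Real.log n := by
  have h := (Real.isLittleO_log_id_atTop.comp_tendsto tendsto_log_natCast).const_mul_left c
  have h1 := h.bound one_pos
  filter_upwards [h1] with n hn
  simp only [Function.comp, id, one_mul, Real.norm_eq_abs] at hn
  rw [abs_of_nonneg (Real.log_natCast_nonneg n)] at hn
  unfold exploration
  linarith [le_abs_self (c * Real.log (Real.log n))]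

theorem eventually_mul_exploration_add_le (c : ℝ) {D : ℝ} (hD : 0 ≤ D) (E : ℝ) :
    ∀ᶠ n : ℕ in atTop, D * exploration c n + E ≤ (n : ℝ) / 4 := by
  have h := ((Real.isLittleO_log_id_atTop.comp_tendsto
    (tendsto_natCast_atTop_atTop (R := ℝ))).const_mul_left (2 * D)).bound (c := 1 / 8) (by norm_num)
  have h2 := tendsto_natCast_atTop_atTop (R := ℝ) |>.eventually_ge_atTop (8 * E)
  filter_upwards [h, h2, eventually_exploration_le c] with n hn h2 h3
  simp only [Function.comp, id, Real.norm_eq_abs, Nat.abs_cast] at hn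
  have := mul_le_mul_of_nonneg_left h3 hD
  linarith [le_abs_self (2 * D * Real.log n)]

/-! ### Pathwise bounds on the pulls of a suboptimal arm. -/

section Pointwise

variable {K : ℕ}

/-- Thresholds for the analysis of the suboptimal decisions: `q` is below the optimal mean, `p k`
above the mean of `k`, and after `m` trials of decision `k` with empirical mean at most `p k` the
index can exceed `r kstar * q` only if `m * d k` is at most the exploration function. -/
structure IsTuning (r θ : Fin K → ℝ) (kstar : Fin K) (ε q : ℝ) (p d : Fin K → ℝ) : Prop where
  q_pos : 0 < q
  q_lt : q < θ kstar
  lt_p : ∀ k, k ≠ kstar → θ k < p k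
  d_pos : ∀ k, k ≠ kstar → 0 < d k
  kl_le : ∀ k, k ≠ kstar → r kstar * θ kstar < r k →
    klReal (θ k) (r kstar * θ kstar / r k) ≤ (1 + ε) * d k
  range_lt : ∀ k, k ≠ kstar → r k < r kstar * θ kstar → r k < r kstar * q
  index : ∀ k, k ≠ kstar → r kstar * θ kstar ≤ r k →
    ∃ y, p k ≤ y ∧ 0 < y ∧ y < 1 ∧ r k * y < r kstar * q ∧ d k = klReal (p k) y

variable {Ω : Type*}

open Classical in
/-- The number of exceptional events up to the horizon `T`. -/
noncomputable def noise (c : ℝ) (θ : Fin K → ℝ) (kstar : Fin K) (q : ℝ) (p : Fin K → ℝ)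
    (X : Fin K → ℕ → Ω → ℝ) (T : ℕ) (ω : Ω) : ℕ :=
  ∑ k ∈ Finset.univ.erase kstar,
      #{m ∈ Finset.range (T + 1) | ω ∈ {ω | p k < runningAvg (X k) m ω}}
    + #{n ∈ Finset.Icc 3 T | ω ∈ underestimates c q (X kstar) n}
    + #{n ∈ Finset.Icc 3 T | ω ∈ lowAverage (θ kstar) (X kstar) n}

variable {c : ℝ} {r θ : Fin K → ℝ} {kstar : Fin K} {ε q : ℝ} {p d : Fin K → ℝ}
  {X : Fin K → ℕ → Ω → ℝ} {a : ℕ → Ω → Fin K}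

theorem noise_mono {S T : ℕ} (hST : S ≤ T) (ω : Ω) :
    noise c θ kstar q p X S ω ≤ noise c θ kstar q p X T ω := by
  unfold noise
  gcongr

open Classical in
theorem card_runningAvg_gt_add_le_noise {k : Fin K} (hk : k ≠ kstar) (T : ℕ) (ω : Ω) :
    #{m ∈ Finset.range (T + 1) | p k < runningAvg (X k) m ω}
      + #{n ∈ Finset.Icc 3 T | ω ∈ underestimates c q (X kstar) n}
      + #{n ∈ Finset.Icc 3 T | ω ∈ lowAverage (θ kstar) (X kstar) n}
      ≤ noise c θ kstar q p X T ω := by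
  unfold noise
  gcongr
  exact Finset.single_le_sum
    (f := fun k => #{m ∈ Finset.range (T + 1) | ω ∈ {ω | p k < runningAvg (X k) m ω}})
    (fun _ _ => Nat.zero_le _) (Finset.mem_erase.2 ⟨hk, Finset.mem_univ k⟩)

variable [MeasurableSpace Ω]

/-- A taken arm has index at least that of `kstar`. Either the latter is below `r kstar * q`, an
underestimation, or the index of `k` reaches `r kstar * q`, which its range and its number of trials
must permit. -/
theorem IsTuning.pull_cases (ht : IsTuning r θ kstar ε q p d) (hr : ∀ k, 0 < r k)
    (hθ : ∀ k, θ k ∈ Set.Icc (0 : ℝ) 1) (hc : 0 ≤ c)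
    (hX : ∀ k i ω, X k i ω = 0 ∨ X k i ω = 1) (ha : IsKLRUCB r c X a) {k : Fin K}
    (hk : k ≠ kstar) {n : ℕ} (hn : K + 3 ≤ n) {ω : Ω} (han : a n ω = k) :
    p k < runningAvg (X k) (pullsBefore a k n ω) ω ∨ ω ∈ underestimates c q (X kstar) n ∨
      (r kstar * q ≤ r k ∧ pullsBefore a k n ω * d k ≤ exploration c n) := by
  have hf : 0 ≤ exploration c n := exploration_nonneg hc (by omega)
  have hsel := ha.select n (by omega) ω kstar
  rw [han] at hsel
  by_cases hp : p k < runningAvg (X k) (pullsBefore a k n ω) ω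
  · exact Or.inl hp
  refine Or.inr (or_iff_not_imp_left.2 fun hD => ?_)
  have hidx : r kstar * q ≤ klIndex r c X a k n ω := by
    refine le_trans (not_lt.1 fun hlt => hD ?_) hsel
    have hq1 : q < 1 := ht.q_lt.trans_le (hθ kstar).2
    exact ⟨pullsBefore a kstar n ω,
      Finset.mem_Icc.2 ⟨ha.pullsBefore_pos kstar (by omega) ω, pullsBefore_le n ω⟩,
      of_klIndex_lt (hX kstar) (hr kstar) hf ht.q_pos hq1 hlt⟩
  have hrk : r kstar * q ≤ r k := hidx.trans (klIndex_le (hX k) (hr k) hf)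
  refine ⟨hrk, ?_⟩
  obtain ⟨y, hpy, hy0, hy1, hlt, hd⟩ := ht.index k hk
    (not_lt.1 fun h => absurd hrk (not_le.2 (ht.range_lt k hk h)))
  rw [hd]
  exact of_lt_klIndex (hX k) (hr k) (ha.pullsBefore_pos k (by omega) ω) hpy hy0 hy1
    (not_lt.1 hp) (hlt.trans_le hidx)

theorem IsTuning.pullsBefore_le_of_lt (ht : IsTuning r θ kstar ε q p d) (hr : ∀ k, 0 < r k)
    (hθ : ∀ k, θ k ∈ Set.Icc (0 : ℝ) 1) (hc : 0 ≤ c)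
    (hX : ∀ k i ω, X k i ω = 0 ∨ X k i ω = 1) (ha : IsKLRUCB r c X a) {k : Fin K}
    (hk : k ≠ kstar) (hrk : r k < r kstar * θ kstar) (T : ℕ) (ω : Ω) :
    pullsBefore a k (T + 1) ω ≤ K + 3 + noise c θ kstar q p X T ω := by
  classical
  have h := pullsBefore_succ_le (a := a) (k := k) (n₀ := K + 3) (T := T) (by omega) ω
    (fun m => p k < runningAvg (X k) m ω) (fun n => ω ∈ underestimates c q (X kstar) n) ?_
  · have h2 := card_runningAvg_gt_add_le_noise (c := c) (θ := θ) (q := q) (p := p) (X := X) hk T ω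
    have h3 : #{n ∈ Finset.Icc (K + 3) T | ω ∈ underestimates c q (X kstar) n} ≤
        #{n ∈ Finset.Icc 3 T | ω ∈ underestimates c q (X kstar) n} :=
      Finset.card_le_card (Finset.filter_subset_filter _ (Finset.Icc_subset_Icc_left (by omega)))
    omega
  · intro n hn _ han
    rcases ht.pull_cases hr hθ hc hX ha hk hn han with h | h | h
    · exact Or.inl h
    · exact Or.inr h
    · exact absurd h.1 (not_le.2 (ht.range_lt k hk hrk))

theorem IsTuning.pullsBefore_le_exploration (ht : IsTuning r θ kstar ε q p d)
    (hr : ∀ k, 0 < r k) (hθ : ∀ k, θ k ∈ Set.Icc (0 : ℝ) 1) (hc : 0 ≤ c)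
    (hX : ∀ k i ω, X k i ω = 0 ∨ X k i ω = 1) (ha : IsKLRUCB r c X a) {k : Fin K}
    (hk : k ≠ kstar) {T : ℕ} (hT : 3 ≤ T) (ω : Ω) :
    (pullsBefore a k (T + 1) ω : ℝ) ≤
      exploration c T / d k + (K + 4) + noise c θ kstar q p X T ω := by
  classical
  have hd := ht.d_pos k hk
  have h := pullsBefore_succ_le (a := a) (k := k) (n₀ := K + 3) (T := T) (by omega) ω
    (fun m => p k < runningAvg (X k) m ω ∨ (m : ℝ) ≤ exploration c T / d k)
    (fun n => ω ∈ underestimates c q (X kstar) n) ?_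
  · have h2 := card_runningAvg_gt_add_le_noise (c := c) (θ := θ) (q := q) (p := p) (X := X) hk T ω
    have h3 : #{n ∈ Finset.Icc (K + 3) T | ω ∈ underestimates c q (X kstar) n} ≤
        #{n ∈ Finset.Icc 3 T | ω ∈ underestimates c q (X kstar) n} :=
      Finset.card_le_card (Finset.filter_subset_filter _ (Finset.Icc_subset_Icc_left (by omega)))
    rw [Finset.filter_or] at h
    have h4 := Finset.card_union_le {m ∈ Finset.range (T + 1) | p k < runningAvg (X k) m ω}
      {m ∈ Finset.range (T + 1) | ((m : ℕ) : ℝ) ≤ exploration c T / d k}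
    have h5 := card_filter_natCast_le (T + 1) (div_nonneg (exploration_nonneg hc hT) hd.le)
    have h6 : pullsBefore a k (T + 1) ω ≤ K + 3 + noise c θ kstar q p X T ω +
        #{m ∈ Finset.range (T + 1) | ((m : ℕ) : ℝ) ≤ exploration c T / d k} := by omega
    have h7 : (pullsBefore a k (T + 1) ω : ℝ) ≤ K + 3 + noise c θ kstar q p X T ω +
        (#{m ∈ Finset.range (T + 1) | ((m : ℕ) : ℝ) ≤ exploration c T / d k} : ℕ) := by
      exact_mod_cast h6
    linarith
  · intro n hn hnT han
    rcases ht.pull_cases hr hθ hc hX ha hk hn han with h | h | h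
    · exact Or.inl (Or.inl h)
    · exact Or.inr h
    · refine Or.inl (Or.inr ?_)
      rw [le_div_iff₀ hd]
      exact h.2.trans (exploration_mono hc (by omega) hnT)

/-- The other arms then share at least about `n / 2` pulls, of which the exploration terms explain
at most `n / 4`; `noise` must pay for the rest. The `+ 1` in the smallness condition accounts for
only `n - 1` slots preceding slot `n`. -/
theorem IsTuning.le_noise_of_pullsBefore_lt (ht : IsTuning r θ kstar ε q p d)
    (hr : ∀ k, 0 < r k) (hθ : ∀ k, θ k ∈ Set.Icc (0 : ℝ) 1) (hc : 0 ≤ c)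
    (hX : ∀ k i ω, X k i ω = 0 ∨ X k i ω = 1) (ha : IsKLRUCB r c X a) {n : ℕ} (hn4 : 4 ≤ n)
    (hn : (∑ k ∈ Finset.univ.erase kstar, 1 / d k) * exploration c n + (K * (K + 4) + 1)
      ≤ (n : ℝ) / 4) {T : ℕ} (hnT : n ≤ T) {ω : Ω}
    (hlt : (pullsBefore a kstar n ω : ℝ) < n / 2) :
    (n : ℝ) ≤ 4 * K * noise c θ kstar q p X T ω := by
  obtain ⟨m, rfl⟩ : ∃ m, n = m + 1 := ⟨n - 1, by omega⟩
  have hsum := sum_pullsBefore a (m + 1) ω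
  rw [← Finset.add_sum_erase _ _ (Finset.mem_univ kstar), Nat.add_sub_cancel] at hsum
  have hsum' : (pullsBefore a kstar (m + 1) ω : ℝ)
      + ∑ k ∈ Finset.univ.erase kstar, (pullsBefore a k (m + 1) ω : ℝ) = m := by
    exact_mod_cast hsum
  have hle : ∑ k ∈ Finset.univ.erase kstar, (pullsBefore a k (m + 1) ω : ℝ) ≤
      ∑ k ∈ Finset.univ.erase kstar, (1 / d k * exploration c (m + 1 : ℕ)
        + ((K + 4) + noise c θ kstar q p X T ω)) := by
    refine Finset.sum_le_sum fun k hk => ?_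
    have hk' := (Finset.mem_erase.1 hk).1
    have h1 := ht.pullsBefore_le_exploration hr hθ hc hX ha hk' (T := m) (by omega) ω
    have h2 : (noise c θ kstar q p X m ω : ℝ) ≤ noise c θ kstar q p X T ω := by
      exact_mod_cast noise_mono (by omega) ω
    have h3 : exploration c m / d k ≤ 1 / d k * exploration c (m + 1 : ℕ) := by
      rw [one_div_mul_eq_div]
      exact div_le_div_of_nonneg_right (exploration_mono hc (by omega) (by omega))
        (ht.d_pos k hk').le
    linarith
  rw [Finset.sum_add_distrib, ← Finset.sum_mul, Finset.sum_const, nsmul_eq_mul] at hle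
  have hcard : ((Finset.univ.erase kstar).card : ℝ) ≤ K := by
    have := Finset.card_le_univ (Finset.univ.erase kstar)
    rw [Fintype.card_fin] at this
    exact_mod_cast this
  have hle2 := mul_le_mul_of_nonneg_right hcard
    (show (0 : ℝ) ≤ (K + 4) + noise c θ kstar q p X T ω by positivity)
  push_cast at *
  nlinarith

/-- With `δ = n ^ (-1/4)`, the divergence from `x` to `1 - δ` is at least `(1 - x) / 8 * log n`,
against an exploration level of at most `2 * log n`. More than `16 / (1 - x)` trials thus keep the
index of `k` at or below `r k * (1 - δ)`, and the optimal arm's average, never above its own index,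
inherits this bound. -/
theorem lowAverage_of_pull (hr : ∀ k, 0 < r k) (hc : 0 ≤ c)
    (hX : ∀ k i ω, X k i ω = 0 ∨ X k i ω = 1) (ha : IsKLRUCB r c X a) {k : Fin K}
    (hrk : r k = r kstar * θ kstar) {x : ℝ} (hx0 : 0 ≤ x) (hx1 : x < 1)
    {n : ℕ} (hn : K + 3 ≤ n) (hf : exploration c n ≤ 2 * Real.log n)
    (hlog : Real.log 2 < (1 - x) / 8 * Real.log n) (hxn : (n : ℝ) ^ (-(1 / 4) : ℝ) ≤ 1 - x) {ω : Ω}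
    (han : a n ω = k) (havg : runningAvg (X k) (pullsBefore a k n ω) ω ≤ x)
    (hpulls : 16 / (1 - x) < pullsBefore a k n ω)
    (hstar : (n : ℝ) / 2 ≤ pullsBefore a kstar n ω) :
    ω ∈ lowAverage (θ kstar) (X kstar) n := by
  have hf0 : 0 ≤ exploration c n := exploration_nonneg hc (by omega)
  have hn0 : (0 : ℝ) < n := by
    have : 0 < n := by omega
    exact_mod_cast this
  have hn1 : (1 : ℝ) < n := by
    have : 1 < n := by omega
    exact_mod_cast this
  have hsel := ha.select n (by omega) ω kstar
  rw [han] at hsel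
  set δ := (n : ℝ) ^ (-(1 / 4) : ℝ) with hδ
  have hδ0 : 0 < δ := by positivity
  have hδ1 : δ < 1 := Real.rpow_lt_one_of_one_lt_of_neg hn1 (by norm_num)
  have hidx : klIndex r c X a k n ω ≤ r k * (1 - δ) := by
    by_contra! hlt
    have h1 := of_lt_klIndex (hX k) (hr k) (ha.pullsBefore_pos k (by omega) ω) (p := x)
      (by linarith) (by linarith) (by linarith) havg hlt
    have h2 := klReal_ge_log hx0 (q := 1 - δ) (by linarith) (by linarith)
    rw [sub_sub_cancel, hδ, Real.log_rpow hn0, ← hδ] at h2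
    have h3 : (1 - x) / 8 * Real.log n ≤ klReal x (1 - δ) := by linarith
    have hl : 0 < Real.log n := Real.log_pos hn1
    rw [div_lt_iff₀ (by linarith)] at hpulls
    have h4 := mul_le_mul_of_nonneg_left h3 (Nat.cast_nonneg (α := ℝ) (pullsBefore a k n ω))
    nlinarith [mul_lt_mul_of_pos_right hpulls hl]
  refine ⟨pullsBefore a kstar n ω,
    Finset.mem_Icc.2 ⟨ha.pullsBefore_pos kstar (by omega) ω, pullsBefore_le n ω⟩, hstar, ?_⟩
  have h5 := (runningAvg_le_klIndex (a := a) (ω := ω) (hX kstar) (hr kstar) hf0).trans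
    (hsel.trans hidx)
  rw [hrk, mul_assoc] at h5
  have := le_of_mul_le_mul_left h5 (hr kstar)
  linarith

theorem IsTuning.exists_pullsBefore_le_of_eq (ht : IsTuning r θ kstar ε q p d)
    (hr : ∀ k, 0 < r k) (hθ : ∀ k, θ k ∈ Set.Icc (0 : ℝ) 1) (hc : 0 ≤ c) {k : Fin K}
    (hk : k ≠ kstar) (hrk : r k = r kstar * θ kstar) :
    ∃ A : ℝ, 0 ≤ A ∧ ∀ (Ω : Type u) [MeasurableSpace Ω] (X : Fin K → ℕ → Ω → ℝ)
      (a : ℕ → Ω → Fin K), (∀ k i ω, X k i ω = 0 ∨ X k i ω = 1) → IsKLRUCB r c X a →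
      ∀ (T : ℕ) (ω : Ω), (pullsBefore a k (T + 1) ω : ℝ) ≤
        A * (1 + noise c θ kstar q p X T ω) := by
  classical
  have hp1 : p k < 1 := by
    obtain ⟨y, hpy, -, hy1, -, -⟩ := ht.index k hk hrk.ge
    linarith
  have hp0 : 0 ≤ p k := (hθ k).1.trans (ht.lt_p k hk).le
  have hD : 0 ≤ ∑ k ∈ Finset.univ.erase kstar, 1 / d k := Finset.sum_nonneg fun k hk =>
    (one_div_pos.2 (ht.d_pos k (Finset.mem_erase.1 hk).1)).le
  have hev : ∀ᶠ n : ℕ in atTop, exploration c n ≤ 2 * Real.log n ∧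
      Real.log 2 < (1 - p k) / 8 * Real.log n ∧ (n : ℝ) ^ (-(1 / 4) : ℝ) ≤ 1 - p k ∧
      (∑ k ∈ Finset.univ.erase kstar, 1 / d k) * exploration c n + (K * (K + 4) + 1)
        ≤ (n : ℝ) / 4 := by
    have h1 := (tendsto_log_natCast.const_mul_atTop
      (show 0 < (1 - p k) / 8 by linarith)).eventually_gt_atTop (Real.log 2)
    have h2 := ((tendsto_rpow_neg_atTop (y := 1 / 4) (by norm_num)).comp
      (tendsto_natCast_atTop_atTop (R := ℝ))).eventually_le_const
        (show 0 < 1 - p k by linarith)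
    filter_upwards [eventually_exploration_le c, h1, h2,
      eventually_mul_exploration_add_le c hD (K * (K + 4) + 1)] with n a1 a2 a3 a4
    exact ⟨a1, a2, a3, a4⟩
  obtain ⟨n₁, hn₁⟩ := eventually_atTop.1 hev
  set n₀ := max n₁ (K + 4) with hn₀
  have h1p : 0 < 1 - p k := by linarith
  -- Initial slots, trials up to `16 / (1 - p k)`, one rounding unit for each of the two counts, and
  -- `4 * K` for the slots `n ≤ W`.
  refine ⟨n₀ + 16 / (1 - p k) + 2 + 4 * K, by positivity, ?_⟩
  intro Ω _ X a hX ha T ω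
  set W : ℝ := 4 * K * noise c θ kstar q p X T ω with hW
  have hK4 : K + 4 ≤ n₀ := le_max_right _ _
  have h := pullsBefore_succ_le (a := a) (k := k) (n₀ := n₀) (T := T) (by omega) ω
    (fun m => p k < runningAvg (X k) m ω ∨ (m : ℝ) ≤ 16 / (1 - p k))
    (fun n => ω ∈ lowAverage (θ kstar) (X kstar) n ∨ (n : ℝ) ≤ W) ?_
  · have h2 := card_runningAvg_gt_add_le_noise (c := c) (θ := θ) (q := q) (p := p) (X := X) hk T ω
    have h3 : #{n ∈ Finset.Icc n₀ T | ω ∈ lowAverage (θ kstar) (X kstar) n} ≤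
        #{n ∈ Finset.Icc 3 T | ω ∈ lowAverage (θ kstar) (X kstar) n} :=
      Finset.card_le_card (Finset.filter_subset_filter _ (Finset.Icc_subset_Icc_left (by omega)))
    rw [Finset.filter_or, Finset.filter_or] at h
    have h4 := Finset.card_union_le {m ∈ Finset.range (T + 1) | p k < runningAvg (X k) m ω}
      {m ∈ Finset.range (T + 1) | ((m : ℕ) : ℝ) ≤ 16 / (1 - p k)}
    have h5 := Finset.card_union_le
      {n ∈ Finset.Icc n₀ T | ω ∈ lowAverage (θ kstar) (X kstar) n}
      {n ∈ Finset.Icc n₀ T | ((n : ℕ) : ℝ) ≤ W}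
    have h6 := card_filter_natCast_le (T + 1) (L := 16 / (1 - p k))
      (div_nonneg (by norm_num) (by linarith))
    have h7 := card_filter_natCast_le (T + 1) (L := W) (by positivity)
    have h8 : #{n ∈ Finset.Icc n₀ T | ((n : ℕ) : ℝ) ≤ W} ≤
        #{n ∈ Finset.range (T + 1) | ((n : ℕ) : ℝ) ≤ W} := by
      refine Finset.card_le_card (Finset.filter_subset_filter _ fun n hn => ?_)
      rw [Finset.mem_Icc] at hn
      exact Finset.mem_range.2 (by omega)
    have h9 : pullsBefore a k (T + 1) ω ≤ n₀ + noise c θ kstar q p X T ω +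
        #{m ∈ Finset.range (T + 1) | ((m : ℕ) : ℝ) ≤ 16 / (1 - p k)} +
        #{n ∈ Finset.range (T + 1) | ((n : ℕ) : ℝ) ≤ W} := by omega
    have h10 : (pullsBefore a k (T + 1) ω : ℝ) ≤ n₀ + noise c θ kstar q p X T ω +
        (#{m ∈ Finset.range (T + 1) | ((m : ℕ) : ℝ) ≤ 16 / (1 - p k)} : ℕ) +
        (#{n ∈ Finset.range (T + 1) | ((n : ℕ) : ℝ) ≤ W} : ℕ) := by exact_mod_cast h9
    have hN : (0 : ℝ) ≤ noise c θ kstar q p X T ω := Nat.cast_nonneg _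
    have h11 : (0 : ℝ) ≤ 16 / (1 - p k) := div_nonneg (by norm_num) (by linarith)
    have h12 : (0 : ℝ) ≤ (n₀ + 16 / (1 - p k)) * noise c θ kstar q p X T ω := by positivity
    have h13 : (0 : ℝ) ≤ K := Nat.cast_nonneg K
    nlinarith
  · intro n hn hnT han
    obtain ⟨hf, hl2, hxn, hsm⟩ := hn₁ n ((le_max_left _ _).trans hn)
    by_cases h1 : p k < runningAvg (X k) (pullsBefore a k n ω) ω
    · exact Or.inl (Or.inl h1)
    by_cases h2 : (pullsBefore a k n ω : ℝ) ≤ 16 / (1 - p k)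
    · exact Or.inl (Or.inr h2)
    refine Or.inr ?_
    by_cases h3 : (pullsBefore a kstar n ω : ℝ) < n / 2
    · exact Or.inr (ht.le_noise_of_pullsBefore_lt hr hθ hc hX ha (by omega) hsm hnT h3)
    · exact Or.inl (lowAverage_of_pull hr hc hX ha hrk hp0 hp1 (by omega) hf hl2 hxn han
        (not_lt.1 h1) (not_le.1 h2) (not_lt.1 h3))

end Pointwise

/-! ### Choice of the thresholds. -/

theorem exists_klReal_le_mul {x y ε : ℝ} (hx : 0 ≤ x) (hxy : x < y) (hy : y < 1) (hε : 0 < ε) :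
    ∃ p z, x < p ∧ p < z ∧ z < y ∧ klReal x y ≤ (1 + ε) * klReal p z := by
  have hpos := klReal_pos hx hxy hy
  have hcont : ContinuousAt (fun η : ℝ => klReal (x + η) (y - η)) 0 := by
    have h1 : ContinuousAt (fun η : ℝ => (x + η, y - η)) 0 := by fun_prop
    have h2 := continuousAt_klReal (p := x) (q := y) (by linarith) hy
    exact ContinuousAt.comp (f := fun η : ℝ => (x + η, y - η)) (by simpa using h2) h1
  have hlt : klReal x y / (1 + ε) < klReal (x + 0) (y - 0) := by
    rw [add_zero, sub_zero, div_lt_iff₀ (by linarith)]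
    nlinarith
  have h1 : ∀ᶠ η : ℝ in nhdsWithin 0 (Set.Ioi 0), klReal x y / (1 + ε) < klReal (x + η) (y - η) :=
    (hcont.eventually (lt_mem_nhds hlt)).filter_mono nhdsWithin_le_nhds
  have h2 : ∀ᶠ η : ℝ in nhdsWithin 0 (Set.Ioi 0), η ∈ Set.Ioo 0 ((y - x) / 2) :=
    Ioo_mem_nhdsGT (by linarith)
  obtain ⟨η, hη, hη0, hη1⟩ := (h1.and h2).exists
  refine ⟨x + η, y - η, by linarith, by linarith, by linarith, ?_⟩
  rw [div_lt_iff₀ (by linarith)] at hη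
  linarith

section Tuning

variable {K : ℕ} {r θ : Fin K → ℝ} {kstar : Fin K}

/-- Stated for all `q` close enough to `θ kstar` from below, so that one `q` serves the finitely
many arms at once. -/
theorem eventually_exists_tuning (hr : ∀ k, 0 < r k) (hθ : ∀ k, θ k ∈ Set.Icc (0 : ℝ) 1) {k : Fin K}
    (hk : r k * θ k < r kstar * θ kstar) {ε : ℝ} (hε : 0 < ε) :
    ∀ᶠ q in nhdsWithin (θ kstar) (Set.Iio (θ kstar)), ∃ p d : ℝ, θ k < p ∧ 0 < d ∧
      (r kstar * θ kstar < r k → klReal (θ k) (r kstar * θ kstar / r k) ≤ (1 + ε) * d) ∧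
      (r k < r kstar * θ kstar → r k < r kstar * q) ∧
      (r kstar * θ kstar ≤ r k →
        ∃ y, p ≤ y ∧ 0 < y ∧ y < 1 ∧ r k * y < r kstar * q ∧ d = klReal p y) := by
  have hlim : ∀ b, b < r kstar * θ kstar →
      ∀ᶠ q in nhdsWithin (θ kstar) (Set.Iio (θ kstar)), b < r kstar * q := by
    intro b hb
    have hc : ContinuousAt (fun q => r kstar * q) (θ kstar) := by fun_prop
    exact (hc.eventually (lt_mem_nhds hb)).filter_mono nhdsWithin_le_nhds
  rcases lt_or_ge (r k) (r kstar * θ kstar) with hlt | hge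
  · filter_upwards [hlim _ hlt] with q hq
    -- For an arm of too short range `p` and `d` matter little: any `p > θ k` and `d > 0` will do.
    exact ⟨θ k + 1, 1, by linarith, one_pos, fun h => absurd h hlt.not_gt, fun _ => hq,
      fun h => absurd h (not_le.2 hlt)⟩
  · have hθk := (hθ k).1
    obtain ⟨p, y, h1, h2, h3, h4⟩ : ∃ p y, θ k < p ∧ p < y ∧ y < r kstar * θ kstar / r k ∧
        (r kstar * θ kstar < r k →
          klReal (θ k) (r kstar * θ kstar / r k) ≤ (1 + ε) * klReal p y) := by
      have hlt : θ k < r kstar * θ kstar / r k := by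
        rw [lt_div_iff₀ (hr k)]; linarith
      rcases hge.eq_or_lt with heq | hgt
      · obtain ⟨p, h1, h2⟩ := exists_between hlt
        obtain ⟨y, h3, h4⟩ := exists_between h2
        exact ⟨p, y, h1, h3, h4, fun h => absurd h heq.not_lt⟩
      · obtain ⟨p, y, h1, h2, h3, h4⟩ := exists_klReal_le_mul hθk hlt
          (by rw [div_lt_one (hr k)]; exact hgt) hε
        exact ⟨p, y, h1, h2, h3, fun _ => h4⟩
    have hy1 : y < 1 := h3.trans_le ((div_le_one (hr k)).2 hge)
    rw [lt_div_iff₀ (hr k)] at h3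
    filter_upwards [hlim (r k * y) (by linarith)] with q hq
    exact ⟨p, klReal p y, h1, klReal_pos (by linarith) h2 hy1, h4,
      fun h => absurd h hge.not_gt, fun _ => ⟨y, h2.le, by linarith, hy1, hq, rfl⟩⟩

theorem exists_isTuning (hr : ∀ k, 0 < r k) (hθ : ∀ k, θ k ∈ Set.Icc (0 : ℝ) 1)
    (hkstar : ∀ k, k ≠ kstar → r k * θ k < r kstar * θ kstar) (hpos : 0 < θ kstar) {ε : ℝ}
    (hε : 0 < ε) : ∃ q p d, IsTuning r θ kstar ε q p d := by
  have h1 : ∀ᶠ q in nhdsWithin (θ kstar) (Set.Iio (θ kstar)), q ∈ Set.Ioo 0 (θ kstar) :=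
    Ioo_mem_nhdsLT hpos
  have h2 := eventually_all.2 fun k => eventually_imp_distrib_left.2 fun hk : k ≠ kstar =>
    eventually_exists_tuning hr hθ (hkstar k hk) hε
  obtain ⟨q, hq, hall⟩ := (h1.and h2).exists
  have : ∀ k, ∃ p d : ℝ, k ≠ kstar → (θ k < p ∧ 0 < d ∧
      (r kstar * θ kstar < r k → klReal (θ k) (r kstar * θ kstar / r k) ≤ (1 + ε) * d) ∧
      (r k < r kstar * θ kstar → r k < r kstar * q) ∧
      (r kstar * θ kstar ≤ r k →
        ∃ y, p ≤ y ∧ 0 < y ∧ y < 1 ∧ r k * y < r kstar * q ∧ d = klReal p y)) := by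
    intro k
    by_cases hk : k = kstar
    · exact ⟨0, 0, fun h => absurd hk h⟩
    · obtain ⟨p, d, h⟩ := hall k hk
      exact ⟨p, d, fun _ => h⟩
  choose p d h using this
  exact ⟨q, p, d, hq.1, hq.2, fun k hk => (h k hk).1, fun k hk => (h k hk).2.1,
    fun k hk => (h k hk).2.2.1, fun k hk => (h k hk).2.2.2.1, fun k hk => (h k hk).2.2.2.2⟩

theorem IsTuning.exists_pullsBefore_le {ε q c : ℝ} {p d : Fin K → ℝ}
    (ht : IsTuning r θ kstar ε q p d) (hr : ∀ k, 0 < r k)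
    (hθ : ∀ k, θ k ∈ Set.Icc (0 : ℝ) 1) (hc : 0 ≤ c) {k : Fin K} (hk : k ≠ kstar) :
    ∃ A : ℝ, 0 ≤ A ∧ ∀ (Ω : Type u) [MeasurableSpace Ω] (X : Fin K → ℕ → Ω → ℝ)
      (a : ℕ → Ω → Fin K), (∀ k i ω, X k i ω = 0 ∨ X k i ω = 1) → IsKLRUCB r c X a →
      ∀ T : ℕ, 3 ≤ T → ∀ ω : Ω, (pullsBefore a k (T + 1) ω : ℝ) ≤
        (if r kstar * θ kstar < r k then exploration c T / d k else 0) +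
          A * (1 + noise c θ kstar q p X T ω) := by
  rcases lt_trichotomy (r k) (r kstar * θ kstar) with hlt | heq | hgt
  · refine ⟨K + 3, by positivity, fun Ω _ X a hX ha T _ ω => ?_⟩
    rw [if_neg hlt.not_gt, zero_add]
    have h : (pullsBefore a k (T + 1) ω : ℝ) ≤ K + 3 + noise c θ kstar q p X T ω := by
      exact_mod_cast ht.pullsBefore_le_of_lt hr hθ hc hX ha hk hlt T ω
    have : (0 : ℝ) ≤ (K + 2) * noise c θ kstar q p X T ω := by positivity
    linarith
  · obtain ⟨A, hA, h⟩ := ht.exists_pullsBefore_le_of_eq hr hθ hc hk heq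
    refine ⟨A, hA, fun Ω _ X a hX ha T _ ω => ?_⟩
    rw [if_neg heq.not_gt, zero_add]
    exact h Ω X a hX ha T ω
  · refine ⟨K + 4, by positivity, fun Ω _ X a hX ha T hT ω => ?_⟩
    rw [if_pos hgt]
    have h := ht.pullsBefore_le_exploration hr hθ hc hX ha hk hT ω
    have : (0 : ℝ) ≤ (K + 3) * noise c θ kstar q p X T ω := by positivity
    linarith

end Tuning

/-! ### Expectations: regret decomposition and bounded noise. -/

section Expectation

variable {Ω : Type*}

theorem natCast_card_filter_mem (s : Finset ℕ) (E : ℕ → Set Ω)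
    [∀ ω, DecidablePred fun i => ω ∈ E i] (ω : Ω) :
    (#{i ∈ s | ω ∈ E i} : ℝ) = ∑ i ∈ s, (E i).indicator (fun _ => (1 : ℝ)) ω := by
  classical
  rw [Finset.card_filter]
  push_cast
  exact Finset.sum_congr rfl fun i _ => by simp only [Set.indicator_apply]

open Classical in
theorem natCast_noise {K : ℕ} {c q : ℝ} {θ p : Fin K → ℝ} {kstar : Fin K}
    {X : Fin K → ℕ → Ω → ℝ} (T : ℕ) (ω : Ω) : (noise c θ kstar q p X T ω : ℝ) =
    ∑ k ∈ Finset.univ.erase kstar,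
      (#{m ∈ Finset.range (T + 1) | ω ∈ {ω | p k < runningAvg (X k) m ω}} : ℝ)
    + (#{n ∈ Finset.Icc 3 T | ω ∈ underestimates c q (X kstar) n} : ℝ)
    + (#{n ∈ Finset.Icc 3 T | ω ∈ lowAverage (θ kstar) (X kstar) n} : ℝ) := by
  unfold noise
  push_cast
  rfl

variable [MeasurableSpace Ω] {μ : Measure Ω}

theorem measurableSet_runningAvg_gt {K : ℕ} {θ p : Fin K → ℝ} {X : Fin K → ℕ → Ω → ℝ} (hX : IsBernoulliRewards μ θ X) (k : Fin K) (m : ℕ) :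
    MeasurableSet {ω | p k < runningAvg (X k) m ω} :=
  measurableSet_lt measurable_const ((hX.isBernoulliSeq k).measurable_runningAvg m)

variable [IsProbabilityMeasure μ]

theorem integrable_card_filter (s : Finset ℕ) {E : ℕ → Set Ω} (hE : ∀ i, MeasurableSet (E i))
    [∀ ω, DecidablePred fun i => ω ∈ E i] :
    Integrable (fun ω => (#{i ∈ s | ω ∈ E i} : ℝ)) μ := by
  simp only [natCast_card_filter_mem]
  exact integrable_finsetSum _ fun i _ => (integrable_const 1).indicator (hE i)

theorem integral_card_filter (s : Finset ℕ) {E : ℕ → Set Ω} (hE : ∀ i, MeasurableSet (E i))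
    [∀ ω, DecidablePred fun i => ω ∈ E i] :
    ∫ ω, (#{i ∈ s | ω ∈ E i} : ℝ) ∂μ = ∑ i ∈ s, μ.real (E i) := by
  simp only [natCast_card_filter_mem]
  rw [integral_finsetSum _ fun i _ => (integrable_const (1 : ℝ)).indicator (hE i)]
  exact Finset.sum_congr rfl fun i _ => integral_indicator_one (hE i)

variable {K : ℕ}

theorem integrable_pullsBefore {a : ℕ → Ω → Fin K} (ha : ∀ n, Measurable (a n)) (k : Fin K)
    (n : ℕ) : Integrable (fun ω => (pullsBefore a k n ω : ℝ)) μ :=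
  integrable_card_filter (E := fun m => {ω | a m ω = k}) (Finset.Ico 1 n)
    fun m => measurableSet_eq_fun (ha m) measurable_const

theorem regret_eq {r θ : Fin K → ℝ} {kstar : Fin K} {a : ℕ → Ω → Fin K}
    (ha : ∀ n, Measurable (a n)) (T : ℕ) :
    regret μ r θ kstar a T = ∑ k ∈ Finset.univ.erase kstar,
      (r kstar * θ kstar - r k * θ k) * ∫ ω, (pullsBefore a k (T + 1) ω : ℝ) ∂μ := by
  have hT : ∑ k, ∫ ω, (pullsBefore a k (T + 1) ω : ℝ) ∂μ = T := by
    rw [← integral_finsetSum _ fun k _ => integrable_pullsBefore ha k (T + 1)]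
    have : ∀ ω, ∑ k, (pullsBefore a k (T + 1) ω : ℝ) = T := by
      intro ω
      exact_mod_cast sum_pullsBefore a (T + 1) ω
    simp [this]
  have h2 : regret μ r θ kstar a T = ∑ k,
      (r kstar * θ kstar - r k * θ k) * ∫ ω, (pullsBefore a k (T + 1) ω : ℝ) ∂μ := by
    unfold regret
    simp only [sub_mul, Finset.sum_sub_distrib]
    rw [← Finset.mul_sum, hT]
    simp only [mul_comm (θ _)]
  rw [h2, ← Finset.add_sum_erase _ _ (Finset.mem_univ kstar), sub_self, zero_mul, zero_add]

variable {c q : ℝ} {θ p : Fin K → ℝ} {kstar : Fin K} {X : Fin K → ℕ → Ω → ℝ}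

theorem integrable_noise (hX : IsBernoulliRewards μ θ X) (T : ℕ) :
    Integrable (fun ω => (noise c θ kstar q p X T ω : ℝ)) μ := by
  classical
  simp only [natCast_noise]
  refine ((integrable_finsetSum _ fun k _ => ?_).add ?_).add ?_
  · exact integrable_card_filter _ (measurableSet_runningAvg_gt hX k)
  · exact integrable_card_filter _ ((hX.isBernoulliSeq kstar).measurableSet_underestimates c q)
  · exact integrable_card_filter _ (hX.isBernoulliSeq kstar).measurableSet_lowAverage

theorem integral_noise (hX : IsBernoulliRewards μ θ X) (T : ℕ) :
    ∫ ω, (noise c θ kstar q p X T ω : ℝ) ∂μ =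
      ∑ k ∈ Finset.univ.erase kstar, ∑ m ∈ Finset.range (T + 1),
          μ.real {ω | p k < runningAvg (X k) m ω}
        + ∑ n ∈ Finset.Icc 3 T, μ.real (underestimates c q (X kstar) n)
        + ∑ n ∈ Finset.Icc 3 T, μ.real (lowAverage (θ kstar) (X kstar) n) := by
  classical
  have h1 := fun k => integrable_card_filter (μ := μ) (Finset.range (T + 1))
    (measurableSet_runningAvg_gt (p := p) hX k)
  have h2 := integrable_card_filter (μ := μ) (Finset.Icc 3 T)
    ((hX.isBernoulliSeq kstar).measurableSet_underestimates c q)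
  have h3 := integrable_card_filter (μ := μ) (Finset.Icc 3 T)
    (hX.isBernoulliSeq kstar).measurableSet_lowAverage
  have h12 : Integrable (fun ω => ∑ k ∈ Finset.univ.erase kstar,
      (#{m ∈ Finset.range (T + 1) | ω ∈ {ω | p k < runningAvg (X k) m ω}} : ℝ)
        + (#{n ∈ Finset.Icc 3 T | ω ∈ underestimates c q (X kstar) n} : ℝ)) μ :=
    (integrable_finsetSum _ fun k _ => h1 k).add h2
  simp only [natCast_noise]
  rw [integral_add h12 h3,
    integral_add (integrable_finsetSum _ fun k _ => h1 k) h2,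
    integral_finsetSum _ fun k _ => h1 k,
    integral_card_filter _ ((hX.isBernoulliSeq kstar).measurableSet_underestimates c q),
    integral_card_filter _ (hX.isBernoulliSeq kstar).measurableSet_lowAverage]
  congr 2
  exact Finset.sum_congr rfl fun k _ =>
    integral_card_filter _ (measurableSet_runningAvg_gt hX k)

/-- The bound is chosen before the probability space, the rewards and the horizon; this gives the
uniformity of the final constants. -/
theorem IsTuning.exists_integral_noise_le {r d : Fin K → ℝ} {ε : ℝ}
    (ht : IsTuning r θ kstar ε q p d) (hθ : ∀ k, θ k ∈ Set.Icc (0 : ℝ) 1) (hc : 0 ≤ c) :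
    ∃ C : ℝ, ∀ (Ω : Type u) [MeasurableSpace Ω] (μ : Measure Ω) [IsProbabilityMeasure μ]
      (X : Fin K → ℕ → Ω → ℝ), IsBernoulliRewards μ θ X → ∀ T : ℕ,
        ∫ ω, (noise c θ kstar q p X T ω : ℝ) ∂μ ≤ C := by
  obtain ⟨C₁, h₁⟩ := exists_sum_measure_underestimates_le.{u} hc ht.q_pos ht.q_lt (hθ kstar).2
  obtain ⟨C₂, h₂⟩ := exists_sum_measure_lowAverage_le.{u} (ht.q_pos.trans ht.q_lt)
  have : ∀ k, ∃ C : ℝ, k ≠ kstar → ∀ (Ω : Type u) [MeasurableSpace Ω] (μ : Measure Ω)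
      [IsProbabilityMeasure μ] (Y : ℕ → Ω → ℝ), IsBernoulliSeq μ (θ k) Y → ∀ T : ℕ,
        ∑ m ∈ Finset.range T, μ.real {ω | p k < runningAvg Y m ω} ≤ C := by
    intro k
    by_cases hk : k = kstar
    · exact ⟨0, fun h => absurd hk h⟩
    · obtain ⟨C, h⟩ := exists_sum_measure_runningAvg_gt_le.{u} (ht.lt_p k hk)
      exact ⟨C, fun _ => h⟩
  choose C₃ h₃ using this
  refine ⟨∑ k ∈ Finset.univ.erase kstar, C₃ k + C₁ + C₂, fun Ω _ μ _ X hX T => ?_⟩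
  rw [integral_noise hX]
  refine add_le_add (add_le_add (Finset.sum_le_sum fun k hk => ?_) ?_) ?_
  · exact h₃ k (Finset.mem_erase.1 hk).1 Ω μ (X k) (hX.isBernoulliSeq k) (T + 1)
  · exact h₁ Ω μ (X kstar) (hX.isBernoulliSeq kstar) T
  · exact h₂ Ω μ (X kstar) (hX.isBernoulliSeq kstar) T

end Expectation

/-! ### The constant as a sum over arms of range above the optimal reward. -/

section Constant

variable {K : ℕ} {r θ : Fin K → ℝ} {kstar : Fin K}

/-- The set defining `kZero` contains `kstar` because `θ kstar ≤ 1`, and its condition on `r k`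
persists upwards since `r` increases. -/
theorem kZero_le_iff (hr : ∀ k, 0 < r k) (hr_mono : StrictMono r) (hθ : θ kstar ≤ 1) (k : Fin K) :
    kZero r θ kstar ≤ (k : WithTop (Fin K)) ↔ r kstar * θ kstar ≤ r k := by
  have hmem : kstar ∈ ({k : Fin K | k ≤ kstar ∧ r kstar * θ kstar / r k ≤ 1} : Finset (Fin K)) := by
    rw [Finset.mem_filter, div_le_one (hr kstar)]
    exact ⟨Finset.mem_univ _, le_rfl, mul_le_of_le_one_right (hr kstar).le hθ⟩
  unfold kZero
  constructor
  · intro h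
    obtain ⟨m, hm⟩ := Finset.min_of_mem hmem
    rw [hm, WithTop.coe_le_coe] at h
    have h1 := Finset.mem_of_min hm
    rw [Finset.mem_filter, div_le_one (hr m)] at h1
    exact h1.2.2.trans (hr_mono.monotone h)
  · intro h
    rcases le_total k kstar with hk | hk
    · refine Finset.min_le (Finset.mem_filter.2 ⟨Finset.mem_univ _, hk, ?_⟩)
      rwa [div_le_one (hr k)]
    · exact (Finset.min_le hmem).trans (WithTop.coe_le_coe.2 hk)

theorem cPrime_eq (hr : ∀ k, 0 < r k) (hr_mono : StrictMono r)
    (hθ : ∀ k, θ k ∈ Set.Icc (0 : ℝ) 1)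
    (hkstar : ∀ k, k ≠ kstar → r k * θ k < r kstar * θ kstar) :
    cPrime r θ kstar = ∑ k ∈ Finset.univ.erase kstar,
      if r kstar * θ kstar < r k then
        (r kstar * θ kstar - r k * θ k) / klReal (θ k) (r kstar * θ kstar / r k) else 0 := by
  unfold cPrime
  have hset : Finset.univ.filter
      (fun k : Fin K => kZero r θ kstar ≤ (k : WithTop (Fin K)) ∧ k ≠ kstar) =
      (Finset.univ.erase kstar).filter (fun k => r kstar * θ kstar ≤ r k) := by
    ext k
    simp [kZero_le_iff hr hr_mono (hθ kstar).2, and_comm]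
  rw [hset, Finset.sum_filter]
  refine Finset.sum_congr rfl fun k hk => ?_
  have hk' := hkstar k (Finset.mem_erase.1 hk).1
  have hpos : 0 < r kstar * θ kstar := (mul_nonneg (hr k).le (hθ k).1).trans_lt hk'
  rcases lt_trichotomy (r kstar * θ kstar) (r k) with hlt | heq | hgt
  · rw [if_pos hlt.le, if_pos hlt,
      bernoulliKL_eq_coe (div_pos hpos (hr k)) ((div_lt_one (hr k)).2 hlt), ← EReal.coe_div,
      EReal.toReal_coe]
  -- Boundary arm: the divergence is `⊤`, so the summand vanishes.
  · have hθk : θ k < 1 := by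
      rw [heq] at hk'
      exact (mul_lt_iff_lt_one_right (hr k)).1 hk'
    rw [if_pos heq.le, if_neg heq.not_lt, heq, div_self (hr k).ne', bernoulliKL_one_right hθk,
      EReal.div_top, EReal.toReal_zero]
  · rw [if_neg (not_le.2 hgt), if_neg hgt.not_gt]

end Constant

/-! ### Assembly of the regret bound. -/

theorem exists_regret_le {K : ℕ} {r : Fin K → ℝ} (hr : ∀ k, 0 < r k) (hr_mono : StrictMono r)
    {θ : Fin K → ℝ} (hθ : ∀ k, θ k ∈ Set.Icc (0 : ℝ) 1) {kstar : Fin K}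
    (hkstar : ∀ k, k ≠ kstar → r k * θ k < r kstar * θ kstar) {c : ℝ} (hc : 0 ≤ c) {ε : ℝ}
    (hε : 0 < ε) :
    ∃ B : ℝ, 0 ≤ B ∧ ∀ (Ω : Type u) [MeasurableSpace Ω] (μ : Measure Ω) [IsProbabilityMeasure μ]
      (X : Fin K → ℕ → Ω → ℝ) (a : ℕ → Ω → Fin K),
      IsBernoulliRewards μ θ X → IsKLRUCB r c X a → ∀ T : ℕ, 3 ≤ T →
        regret μ r θ kstar a T ≤ (1 + ε) * cPrime r θ kstar * exploration c T + B := by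
  rw [cPrime_eq hr hr_mono hθ hkstar]
  -- With a single arm the regret is zero, but `θ kstar` may vanish; a second arm forces `0 < θ
  -- kstar`, which the thresholds need.
  by_cases hex : ∃ k, k ≠ kstar
  swap
  · push Not at hex
    have he : Finset.univ.erase kstar = ∅ := by
      ext k
      simp [hex k]
    refine ⟨0, le_rfl, fun Ω _ μ _ X a _ ha T _ => ?_⟩
    rw [regret_eq ha.measurable, he]
    simp
  obtain ⟨k₁, hk₁⟩ := hex
  have hμ : 0 < r kstar * θ kstar :=
    (mul_nonneg (hr k₁).le (hθ k₁).1).trans_lt (hkstar k₁ hk₁)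
  have hpos : 0 < θ kstar := pos_of_mul_pos_right hμ (hr kstar).le
  obtain ⟨q, p, d, ht⟩ := exists_isTuning hr hθ hkstar hpos hε
  obtain ⟨C, hC⟩ := ht.exists_integral_noise_le.{u} hθ hc
  have : ∀ k, ∃ A : ℝ, 0 ≤ A ∧ (k ≠ kstar → ∀ (Ω : Type u) [MeasurableSpace Ω]
      (X : Fin K → ℕ → Ω → ℝ) (a : ℕ → Ω → Fin K), (∀ k i ω, X k i ω = 0 ∨ X k i ω = 1) →
      IsKLRUCB r c X a → ∀ T : ℕ, 3 ≤ T → ∀ ω : Ω, (pullsBefore a k (T + 1) ω : ℝ) ≤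
        (if r kstar * θ kstar < r k then exploration c T / d k else 0) +
          A * (1 + noise c θ kstar q p X T ω)) := by
    intro k
    by_cases hk : k = kstar
    · exact ⟨0, le_rfl, fun h => absurd hk h⟩
    · obtain ⟨A, hA, h⟩ := ht.exists_pullsBefore_le.{u} hr hθ hc hk
      exact ⟨A, hA, fun _ => h⟩
  choose A hA0 hA using this
  have hgap : ∀ k ∈ Finset.univ.erase kstar, 0 ≤ r kstar * θ kstar - r k * θ k := fun k hk =>
    sub_nonneg.2 (hkstar k (Finset.mem_erase.1 hk).1).le
  refine ⟨∑ k ∈ Finset.univ.erase kstar,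
    (r kstar * θ kstar - r k * θ k) * (A k * (1 + |C|)), Finset.sum_nonneg fun k hk =>
      mul_nonneg (hgap k hk) (mul_nonneg (hA0 k) (by positivity)), ?_⟩
  intro Ω _ μ _ X a hX ha T hT
  have hf := exploration_nonneg hc hT
  rw [regret_eq ha.measurable, Finset.mul_sum, Finset.sum_mul, ← Finset.sum_add_distrib]
  refine Finset.sum_le_sum fun k hk => ?_
  have hk' := (Finset.mem_erase.1 hk).1
  have hint : ∫ ω, (pullsBefore a k (T + 1) ω : ℝ) ∂μ ≤
      (if r kstar * θ kstar < r k then exploration c T / d k else 0) + A k * (1 + |C|) := by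
    have hi : Integrable (fun ω => A k * (1 + (noise c θ kstar q p X T ω : ℝ))) μ :=
      ((integrable_const 1).add (integrable_noise hX T)).const_mul _
    have h1 := integral_mono (integrable_pullsBefore ha.measurable k (T + 1))
      ((integrable_const _).add hi) (hA k hk' Ω X a hX.binary ha T hT)
    refine h1.trans ?_
    have h2 : ∫ ω, (1 + (noise c θ kstar q p X T ω : ℝ)) ∂μ ≤ 1 + |C| := by
      rw [integral_add (integrable_const 1) (integrable_noise hX T)]
      simpa using (hC Ω μ X hX T).trans (le_abs_self C)
    rw [integral_add' (integrable_const _) hi, integral_const_mul]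
    simpa using mul_le_mul_of_nonneg_left h2 (hA0 k)
  refine (mul_le_mul_of_nonneg_left hint (hgap k hk)).trans ?_
  rw [mul_add]
  refine add_le_add ?_ le_rfl
  split_ifs with hlt
  · have hI := ht.kl_le k hk' hlt
    have hI0 : 0 < klReal (θ k) (r kstar * θ kstar / r k) := by
      refine klReal_pos (hθ k).1 ?_ ((div_lt_one (hr k)).2 hlt)
      rw [lt_div_iff₀ (hr k)]
      linarith [hkstar k hk']
    have hd := ht.d_pos k hk'
    have h3 : exploration c T / d k ≤
        (1 + ε) / klReal (θ k) (r kstar * θ kstar / r k) * exploration c T := by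
      rw [div_mul_eq_mul_div, div_le_div_iff₀ hd hI0]
      nlinarith
    calc _ ≤ (r kstar * θ kstar - r k * θ k) *
          ((1 + ε) / klReal (θ k) (r kstar * θ kstar / r k) * exploration c T) :=
          mul_le_mul_of_nonneg_left h3 (hgap k hk)
      _ = _ := by ring
  · simp

theorem one_le_log_log {T : ℕ} (hT : 16 ≤ T) : 1 ≤ Real.log (Real.log T) := by
  have h16 : (16 : ℝ) ≤ T := by exact_mod_cast hT
  have h1 : Real.exp 1 ≤ Real.log T := by
    have h2 : Real.log 16 = 4 * Real.log 2 := by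
      rw [show (16 : ℝ) = 2 ^ 4 by norm_num, Real.log_pow]
      norm_num
    have h3 := Real.log_le_log (by norm_num) h16
    linarith [Real.exp_one_lt_d9, Real.log_two_gt_d9]
  rwa [Real.le_log_iff_exp_le ((Real.exp_pos 1).trans_le h1)]

theorem tendsto_log_log_div_log (C : ℝ) :
    Tendsto (fun T : ℕ => C * Real.log (Real.log T) / Real.log T) atTop (nhds 0) := by
  have h := ((Real.isLittleO_log_id_atTop.tendsto_div_nhds_zero).comp
    tendsto_log_natCast).const_mul C
  rw [mul_zero] at h
  refine h.congr fun T => ?_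
  simp only [Function.comp, id]
  ring

theorem mainTheorem9 {K : ℕ} (r : Fin K → ℝ) (hr_pos : ∀ k, 0 < r k) (hr_mono : StrictMono r)
    (θ : Fin K → ℝ) (hθ_mem : ∀ k, θ k ∈ Set.Icc (0 : ℝ) 1) (hθ_anti : Antitone θ)
    (kstar : Fin K) (hkstar : ∀ k, k ≠ kstar → r k * θ k < r kstar * θ kstar)
    (c : ℝ) (hc : 0 < c) :
    (∀ ε : ℝ, 0 < ε → ∃ (C : ℝ) (T₀ : ℕ),
      ∀ (Ω : Type u) [MeasurableSpace Ω] (μ : Measure Ω) [IsProbabilityMeasure μ]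
        (X : Fin K → ℕ → Ω → ℝ) (a : ℕ → Ω → Fin K),
        IsBernoulliRewards μ θ X → IsKLRUCB r c X a →
        ∀ T : ℕ, T₀ ≤ T →
          regret μ r θ kstar a T
            ≤ (1 + ε) * cPrime r θ kstar * Real.log T + C * Real.log (Real.log T)) ∧
    (∀ (Ω : Type u) [MeasurableSpace Ω] (μ : Measure Ω) [IsProbabilityMeasure μ]
        (X : Fin K → ℕ → Ω → ℝ) (a : ℕ → Ω → Fin K),
        IsBernoulliRewards μ θ X → IsKLRUCB r c X a →
        limsup (fun T : ℕ => ((regret μ r θ kstar a T / Real.log T : ℝ) : EReal)) atTop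
          ≤ (cPrime r θ kstar : EReal)) := by
  have main : ∀ ε : ℝ, 0 < ε → ∃ (C : ℝ) (T₀ : ℕ),
      ∀ (Ω : Type u) [MeasurableSpace Ω] (μ : Measure Ω) [IsProbabilityMeasure μ]
        (X : Fin K → ℕ → Ω → ℝ) (a : ℕ → Ω → Fin K),
        IsBernoulliRewards μ θ X → IsKLRUCB r c X a →
        ∀ T : ℕ, T₀ ≤ T →
          regret μ r θ kstar a T
            ≤ (1 + ε) * cPrime r θ kstar * Real.log T + C * Real.log (Real.log T) := by
    intro ε hε
    obtain ⟨B, hB, h⟩ := exists_regret_le.{u} hr_pos hr_mono hθ_mem hkstar hc.le hε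
    -- The term `c * log (log T)` of the exploration function gives the first summand; from `T = 16`
    -- on, `log (log T) ≥ 1` absorbs `B`.
    refine ⟨(1 + ε) * cPrime r θ kstar * c + B, 16, fun Ω _ μ _ X a hX ha T hT => ?_⟩
    have h1 := h Ω μ X a hX ha T (by omega)
    have h2 := mul_le_mul_of_nonneg_left (one_le_log_log hT) hB
    unfold exploration at h1
    linarith
  refine ⟨main, fun Ω _ μ _ X a hX ha => ?_⟩
  rw [← EReal.le_of_forall_lt_iff_le]
  intro b hb
  rw [EReal.coe_lt_coe_iff] at hb
  -- Any real `b` above the constant leaves room for a small `ε`, and the `log log T` term vanishes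
  -- after division by `log T`.
  obtain ⟨ε, hε, hεb⟩ : ∃ ε : ℝ, 0 < ε ∧ (1 + ε) * cPrime r θ kstar < b := by
    have hcont : ContinuousAt (fun ε : ℝ => (1 + ε) * cPrime r θ kstar) 0 := by fun_prop
    have h1 : ∀ᶠ ε : ℝ in nhdsWithin 0 (Set.Ioi 0), (1 + ε) * cPrime r θ kstar < b :=
      (hcont.eventually (gt_mem_nhds (by simpa using hb))).filter_mono nhdsWithin_le_nhds
    obtain ⟨ε, h2, h3⟩ := (h1.and self_mem_nhdsWithin).exists
    exact ⟨ε, h3, h2⟩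
  obtain ⟨C, T₀, h⟩ := main ε hε
  refine limsup_le_of_le (by isBoundedDefault) ?_
  have h1 := (tendsto_log_log_div_log C).eventually_lt_const (sub_pos.2 hεb)
  filter_upwards [h1, eventually_ge_atTop T₀, eventually_ge_atTop 3] with T hT hT₀ hT3
  have h3 : (3 : ℝ) ≤ T := by exact_mod_cast hT3
  have hl : 0 < Real.log T := Real.log_pos (by linarith)
  rw [EReal.coe_le_coe_iff, div_le_iff₀ hl]
  rw [div_lt_iff₀ hl] at hT
  have := h Ω μ X a hX ha T hT₀
  linarith
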